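/- Let $n\ge 2$ and $1\le \ell\le \lfloor n/2\rfloor$ be integers. A subspace $B\subset\mathbb{R}^n$ is called rational if it has a basis of vectors with rational coordinates, and its height $H(B)$ is then the Euclidean norm of its Plücker coordinates (the maximal minors of the matrix of a basis of $B$, up to a common scalar), normalized to be coprime integers. For subspaces $A,B$ of $\mathbb{R}^n$ of dimension $\ell$, let $\psi_1(A,B)$ be the minimum of $\sin\widehat{(X,Y)}$ over nonzero $X\in A$, $Y\in B$, attained at unit vectors $X_1,Y_1$; inductively, let $\psi_{j+1}(A,B)$ be the minimum of $\sin\widehat{(X,Y)}$ over the nonzero $X\in A$ orthogonal to $X_1,\dots,X_j$ and the nonzero $Y\in B$ orthogonal to $Y_1,\dots,Y_j$, attained at unit vectors $X_{j+1},Y_{j+1}$, for $1\le j<\ell$ (these numbers do not depend on the choices). A subspace $A$ of dimension $\ell$ is called $(\ell,\ell)$-irrational if $\dim(A\cap B)<\ell$ for every rational subspace $B$ of dimension $\ell$; for such $A$, let $\mu_n(A|\ell)_\ell\in[0,+\infty]$ be the supremum of the set of real $\beta>0$ such that $\psi_\ell(A,B)\le H(B)^{-\beta}$ for infinitely many rational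 subspaces $B$ of dimension $\ell$. Then $$\left[1+\frac1{2\ell}+\sqrt{1+\frac1{4\ell^2}},\,+\infty\right]\subset\Big\{\mu_n(A|\ell)_\ell \;:\; A \text{ an } (\ell,\ell)\text{-irrational subspace of } \mathbb{R}^n \text{ of dimension } \ell\Big\}.$$ In particular (case $n=2\ell$), every finite real $\beta\ge 1+\frac1{2\ell}+\sqrt{1+\frac1{4\ell^2}}$ equals $\mu_{2\ell}(A|\ell)_\ell$ for some $(\ell,\ell)$-irrational subspace $A$ of $\mathbb{R}^{2\ell}$ of dimension $\ell$. -/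

import Mathlib

noncomputable section

namespace SubspaceApprox

open Module

variable {n : ℕ}

/-- A subspace of `ℝⁿ` is rational if it has a basis made of vectors with rational coordinates. -/
def IsRational (B : Submodule ℝ (EuclideanSpace ℝ (Fin n))) : Prop :=
  ∃ b : Basis (Fin (finrank ℝ B)) ℝ B,
    ∀ i k, ∃ q : ℚ, (b i : EuclideanSpace ℝ (Fin n)) k = (q : ℝ)

/-- The set of rational subspaces of `ℝⁿ` of dimension `e`. -/
def rationalSubspaces (n e : ℕ) : Set (Submodule ℝ (EuclideanSpace ℝ (Fin n))) :=
  {B | finrank ℝ B = e ∧ IsRational B}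

/-- The set of `(e, j)`-irrational subspaces of `ℝⁿ` of dimension `d`: those which meet every
rational subspace of dimension `e` in dimension less than `j`. -/
def irrationalSubspaces (n d e j : ℕ) : Set (Submodule ℝ (EuclideanSpace ℝ (Fin n))) :=
  {A | finrank ℝ A = d ∧
    ∀ B ∈ rationalSubspaces n e, finrank ℝ (A ⊓ B : Submodule ℝ (EuclideanSpace ℝ (Fin n))) < j}

/-- The vector of maximal minors of the `n × e` matrix with columns `v 0, …, v (e - 1)`, indexed by
the increasing sequences of `e` row indices. -/
def maximalMinors {e : ℕ} (v : Fin e → EuclideanSpace ℝ (Fin n)) : (Fin e ↪o Fin n) → ℝ :=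
  fun I => (Matrix.of fun i j => v j (I i)).det

/-- `Ξ` is a representative of the Plücker coordinates of the subspace `B` of dimension `e`:
a nonzero multiple of the vector of maximal minors of (the matrix of) a basis of `B`. -/
def IsPluckerRepresentative {e : ℕ} (B : Submodule ℝ (EuclideanSpace ℝ (Fin n)))
    (Ξ : (Fin e ↪o Fin n) → ℝ) : Prop :=
  ∃ v : Fin e → EuclideanSpace ℝ (Fin n), LinearIndependent ℝ v ∧
    Submodule.span ℝ (Set.range v) = B ∧ ∃ c : ℝ, c ≠ 0 ∧ Ξ = c • maximalMinors v

/-- The height of a rational subspace `B` of dimension `e`: the Euclidean norm of a representative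
of its Plücker coordinates with coprime integer entries. Such a representative is unique up to
sign, so the infimum is over a set with exactly one element. -/
def height (e : ℕ) (B : Submodule ℝ (EuclideanSpace ℝ (Fin n))) : ℝ :=
  sInf {h : ℝ | ∃ z : (Fin e ↪o Fin n) → ℤ, Finset.univ.gcd z = 1 ∧
    IsPluckerRepresentative B (fun I => (z I : ℝ)) ∧ h = √(∑ I, (z I : ℝ) ^ 2)}

/-- The sine of the geometric angle between two (nonzero) vectors. -/
def psi (X Y : EuclideanSpace ℝ (Fin n)) : ℝ :=
  Real.sin (InnerProductGeometry.angle X Y)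

/-- `X` and `Y` are unit vectors of `A` and `B` which realize the minimum of `psi` over the pairs
of nonzero vectors of `A` and `B`. -/
structure IsMinimizingPair (A B : Submodule ℝ (EuclideanSpace ℝ (Fin n)))
    (X Y : EuclideanSpace ℝ (Fin n)) : Prop where
  left_mem : X ∈ A
  right_mem : Y ∈ B
  norm_left : ‖X‖ = 1
  norm_right : ‖Y‖ = 1
  psi_le : ∀ X' ∈ A, ∀ Y' ∈ B, X' ≠ 0 → Y' ≠ 0 → psi X Y ≤ psi X' Y'

/-- The first `m` pairs `(X 0, Y 0), …, (X (m - 1), Y (m - 1))` are obtained by successive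
minimization: `(X i, Y i)` is a minimizing pair for the orthogonal complement of
`X 0, …, X (i - 1)` in `A` and the orthogonal complement of `Y 0, …, Y (i - 1)` in `B`. -/
def IsAngleSystem (A B : Submodule ℝ (EuclideanSpace ℝ (Fin n))) (m : ℕ)
    (X Y : ℕ → EuclideanSpace ℝ (Fin n)) : Prop :=
  ∀ i < m, IsMinimizingPair (A ⊓ (Submodule.span ℝ (X '' Set.Iio i))ᗮ)
    (B ⊓ (Submodule.span ℝ (Y '' Set.Iio i))ᗮ) (X i) (Y i)

/-- The set of the values `psi X_j Y_j` over all the pairs `(X_j, Y_j)` which can occur as `j`-th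
pair in the successive minimization (`j` is counted from `1`). For
`1 ≤ j ≤ min (dim A) (dim B)` it has exactly one element. -/
def angleSineValues (A B : Submodule ℝ (EuclideanSpace ℝ (Fin n))) (j : ℕ) : Set ℝ :=
  {r | ∃ X Y : ℕ → EuclideanSpace ℝ (Fin n), IsAngleSystem A B j X Y ∧
    r = psi (X (j - 1)) (Y (j - 1))}

/-- `ψ_j(A, B)`, the sine of the `j`-th canonical angle between `A` and `B`,
for `1 ≤ j ≤ min (dim A) (dim B)`. -/
def angleSine (A B : Submodule ℝ (EuclideanSpace ℝ (Fin n))) (j : ℕ) : ℝ :=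
  sInf (angleSineValues A B j)

/-- The exponent `μ_n(A|e)_j`, possibly `+∞`: the supremum of the `β > 0` such that
`ψ_j(A, B) ≤ H(B) ^ (-β)` for infinitely many rational subspaces `B` of dimension `e`. -/
def exponent (A : Submodule ℝ (EuclideanSpace ℝ (Fin n))) (e j : ℕ) : EReal :=
  sSup ((fun β : ℝ => (β : EReal)) ''
    {β : ℝ | 0 < β ∧
      {B | B ∈ rationalSubspaces n e ∧ angleSine A B j ≤ 1 / height e B ^ β}.Infinite})

/-- Minimizing pairs exist, so the successive minimization never stops early. -/
theorem exists_isMinimizingPair {A B : Submodule ℝ (EuclideanSpace ℝ (Fin n))}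
    (hA : A ≠ ⊥) (hB : B ≠ ⊥) : ∃ X Y, IsMinimizingPair A B X Y := by
  obtain ⟨a, ha, ha0⟩ := A.exists_mem_ne_zero_of_ne_bot hA
  obtain ⟨b, hb, hb0⟩ := B.exists_mem_ne_zero_of_ne_bot hB
  let S := ((A : Set (EuclideanSpace ℝ (Fin n))) ∩ Metric.sphere 0 1) ×ˢ
    ((B : Set (EuclideanSpace ℝ (Fin n))) ∩ Metric.sphere 0 1)
  have hS : IsCompact S :=
    ((isCompact_sphere _ _).inter_left A.closed_of_finiteDimensional).prod
      ((isCompact_sphere _ _).inter_left B.closed_of_finiteDimensional)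
  have unit : ∀ x : EuclideanSpace ℝ (Fin n), x ≠ 0 → ‖(‖x‖⁻¹ : ℝ) • x‖ = 1 := by
    intro x hx
    rw [norm_smul, norm_inv, norm_norm, inv_mul_cancel₀ (norm_ne_zero_iff.2 hx)]
  have mem : ∀ x ∈ A, ∀ y ∈ B, x ≠ 0 → y ≠ 0 →
      ((‖x‖⁻¹ : ℝ) • x, (‖y‖⁻¹ : ℝ) • y) ∈ S := by
    intro x hx y hy hx0 hy0
    exact ⟨⟨A.smul_mem _ hx, by simpa using unit x hx0⟩,
      ⟨B.smul_mem _ hy, by simpa using unit y hy0⟩⟩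
  have hc : ContinuousOn (fun p : EuclideanSpace ℝ (Fin n) × EuclideanSpace ℝ (Fin n) =>
      psi p.1 p.2) S := by
    intro p hp
    have h1 : p.1 ≠ 0 := fun h => by simpa [h] using hp.1.2
    have h2 : p.2 ≠ 0 := fun h => by simpa [h] using hp.2.2
    exact (Real.continuous_sin.continuousAt.comp
      (InnerProductGeometry.continuousAt_angle h1 h2)).continuousWithinAt
  obtain ⟨p, hp, hmin⟩ := hS.exists_isMinOn ⟨_, mem a ha b hb ha0 hb0⟩ hc
  refine ⟨p.1, p.2, hp.1.1, hp.2.1, by simpa using hp.1.2, by simpa using hp.2.2, ?_⟩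
  intro x hx y hy hx0 hy0
  have h := hmin (mem x hx y hy hx0 hy0)
  have hx' : 0 < ‖x‖⁻¹ := inv_pos.2 (norm_pos_iff.2 hx0)
  have hy' : 0 < ‖y‖⁻¹ := inv_pos.2 (norm_pos_iff.2 hy0)
  simpa [psi, InnerProductGeometry.angle_smul_left_of_pos _ _ hx',
    InnerProductGeometry.angle_smul_right_of_pos _ _ hy'] using h

/-- The successive minimization can be carried out up to `min (dim A) (dim B)`. -/
theorem exists_isAngleSystem (A B : Submodule ℝ (EuclideanSpace ℝ (Fin n))) (m : ℕ)
    (hA : m ≤ finrank ℝ A) (hB : m ≤ finrank ℝ B) : ∃ X Y, IsAngleSystem A B m X Y := by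
  have key : ∀ (A : Submodule ℝ (EuclideanSpace ℝ (Fin n))) (m : ℕ)
      (X : ℕ → EuclideanSpace ℝ (Fin n)), m < finrank ℝ A →
      A ⊓ (Submodule.span ℝ (X '' Set.Iio m))ᗮ ≠ ⊥ := by
    intro A m X hm h
    have h1 := Submodule.finrank_add_finrank_le_of_disjoint (disjoint_iff.2 h)
    have h2 := (Submodule.span ℝ (X '' Set.Iio m)).finrank_add_finrank_orthogonal
    have h3 : finrank ℝ (Submodule.span ℝ (X '' Set.Iio m)) ≤ m := by
      have := finrank_span_finset_le_card (R := ℝ) ((Finset.range m).image X)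
      rw [Finset.coe_image, Finset.coe_range] at this
      exact this.trans (Finset.card_image_le.trans (by simp))
    omega
  induction m with
  | zero => exact ⟨0, 0, fun i hi => absurd hi (Nat.not_lt_zero i)⟩
  | succ m ih =>
    obtain ⟨X, Y, h⟩ := ih (by omega) (by omega)
    obtain ⟨x, y, hxy⟩ := exists_isMinimizingPair (key A m X (by omega)) (key B m Y (by omega))
    have img : ∀ (Z : ℕ → EuclideanSpace ℝ (Fin n)) (z : EuclideanSpace ℝ (Fin n)) (i : ℕ),
        i ≤ m → Function.update Z m z '' Set.Iio i = Z '' Set.Iio i := by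
      intro Z z i hi
      refine Set.image_congr fun k hk => Function.update_of_ne ?_ _ _
      have : k < i := hk
      omega
    refine ⟨Function.update X m x, Function.update Y m y, fun i hi => ?_⟩
    rw [img X x i (by omega), img Y y i (by omega)]
    rcases Nat.lt_succ_iff_lt_or_eq.1 hi with hi | rfl
    · rw [Function.update_of_ne hi.ne, Function.update_of_ne hi.ne]
      exact h i hi
    · rw [Function.update_self, Function.update_self]
      exact hxy

/-- The infimum defining `angleSine` is over a nonempty set. -/
theorem angleSineValues_nonempty (A B : Submodule ℝ (EuclideanSpace ℝ (Fin n))) (j : ℕ)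
    (hA : j ≤ finrank ℝ A) (hB : j ≤ finrank ℝ B) : (angleSineValues A B j).Nonempty := by
  obtain ⟨X, Y, h⟩ := exists_isAngleSystem A B j hA hB
  exact ⟨_, X, Y, h, rfl⟩

end SubspaceApprox

end

/-! The exponent is realized by subspaces that depend on a single real parameter. Let `A` be spanned
by `e_0, …, e_{ℓ-2}` and `e_{ℓ-1} + ξ e_ℓ`, with `ξ` irrational; then `μ_n(A|ℓ)_ℓ` is the
irrationality exponent of `ξ`. Since the left endpoint of the interval is at least `2`, it suffices
that every `β ≥ 2` is an irrationality exponent (`exists_liouvilleWith_iff_le`), Liouville numbers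
giving `+∞`.

Lower bound (`infinite_of_liouvilleWith`): replacing `ξ` by `p/q` gives a rational subspace of
height `O(q)` whose last angle with `A` has sine at most `|ξ - p/q|`.

Upper bound (`liouvilleWith_of_infinite`): if `ψ_ℓ(A, B)` is small, `B` has a basis close to that of
`A`, so its minors are close to those of `A`, two of which are `1` and `ξ`. The same two entries
`q`, `p` of an integer Plücker vector of `B` satisfy `|ξ - p/q| = O(ψ_ℓ(A, B))`, with `|q|`
comparable to `H(B)`. By the Northcott property, infinitely many `B` produce arbitrarily large
`|q|`. -/

/-! ### Real numbers with prescribed irrationality exponent -/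

theorem exists_convergent_sequences (g : ℤ → ℤ) (hg : ∀ x, 1 ≤ g x) :
    ∃ q p : ℕ → ℤ, q 0 = 1 ∧ (∀ k, 1 ≤ q k) ∧ (∀ k, g (q k) * q k ≤ q (k + 1)) ∧
      (∀ k, q (k + 1) ≤ (g (q k) + 2) * q k) ∧ (∀ k, 2 * q k ≤ q (k + 1)) ∧
      ∀ k, p (k + 1) * q k - p k * q (k + 1) = 1 := by
  -- The state is `(q_{k-1}, q_k, p_{k-1}, p_k)`. This is a continued fraction with minus signs: the
  -- determinant stays equal to `1` instead of alternating, so that `p_k / q_k` increases.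
  let f : ℤ × ℤ × ℤ × ℤ → ℤ × ℤ × ℤ × ℤ := fun s =>
    (s.2.1, (g s.2.1 + 2) * s.2.1 - s.1, s.2.2.2, (g s.2.1 + 2) * s.2.2.2 - s.2.2.1)
  let s : ℕ → ℤ × ℤ × ℤ × ℤ := fun k => f^[k] (0, 1, -1, 0)
  have hs : ∀ k, s (k + 1) = f (s k) := fun k => Function.iterate_succ_apply' f k _
  have inv : ∀ k, 0 ≤ (s k).1 ∧ (s k).1 < (s k).2.1 ∧
      (s k).2.2.2 * (s k).1 - (s k).2.2.1 * (s k).2.1 = 1 := by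
    intro k
    induction k with
    | zero => simp [s]
    | succ k ih =>
      obtain ⟨h1, h2, h3⟩ := ih
      have h4 := hg (s k).2.1
      rw [hs]
      refine ⟨by simp only [f]; omega, ?_, ?_⟩
      · simp only [f]
        nlinarith
      · simp only [f]
        linear_combination h3
  refine ⟨fun k => (s k).2.1, fun k => (s k).2.2.2, rfl, fun k => ?_, fun k => ?_, fun k => ?_,
    fun k => ?_, fun k => ?_⟩
  all_goals
    obtain ⟨h1, h2, h3⟩ := inv k
    have h4 := hg (s k).2.1
    simp only [hs, f]
  · omega
  · nlinarith
  · nlinarith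
  · nlinarith
  · linear_combination h3

/-- A real number together with a sequence of rational numbers which plays the role of its
convergents, and whose denominators grow at a prescribed rate. -/
theorem exists_real_of_growth (g : ℤ → ℤ) (hg : ∀ x, 1 ≤ g x) :
    ∃ (ξ : ℝ) (q p : ℕ → ℤ), q 0 = 1 ∧ (∀ k, 1 ≤ q k) ∧ (∀ k, g (q k) * q k ≤ q (k + 1)) ∧
      (∀ k, q (k + 1) ≤ (g (q k) + 2) * q k) ∧ (∀ k, 2 * q k ≤ q (k + 1)) ∧
      (∀ k, IsCoprime (p k) (q k)) ∧
      (∀ k, 1 / ((q k : ℝ) * q (k + 1)) ≤ ξ - p k / q k) ∧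
      ∀ k, ξ - p k / q k ≤ 2 / ((q k : ℝ) * q (k + 1)) := by
  obtain ⟨q, p, h0, h1, h2, h3, h4, h5⟩ := exists_convergent_sequences g hg
  have pos : ∀ k, (0 : ℝ) < q k := fun k => by exact_mod_cast h1 k
  have dbl : ∀ k, 2 * (q k : ℝ) ≤ q (k + 1) := fun k => by exact_mod_cast h4 k
  have step : ∀ k, (p (k + 1) : ℝ) / q (k + 1) = p k / q k + 1 / ((q k : ℝ) * q (k + 1)) := by
    intro k
    have := pos k
    have := pos (k + 1)
    have h : (p (k + 1) : ℝ) * q k - p k * q (k + 1) = 1 := by exact_mod_cast h5 k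
    field_simp
    linear_combination h
  -- The intervals `[t k, u k]` are nested: the doubling of `q` makes the remaining increments at
  -- most a geometric series of ratio `1/2`, whence the factor `2` in `u`.
  let t : ℕ → ℝ := fun k => p k / q k
  let u : ℕ → ℝ := fun k => p k / q k + 2 / ((q k : ℝ) * q (k + 1))
  have ht : Monotone t := monotone_nat_of_le_succ fun k => by
    have := pos k
    have := pos (k + 1)
    simp only [t, step k]
    have : 0 ≤ 1 / ((q k : ℝ) * q (k + 1)) := by positivity
    linarith
  have hu : Antitone u := antitone_nat_of_succ_le fun k => by
    have a := pos k
    have b := pos (k + 1)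
    have c := pos (k + 2)
    have d := dbl (k + 1)
    have e := dbl k
    simp only [u, step k]
    have : 2 / ((q (k + 1) : ℝ) * q (k + 1 + 1)) ≤ 1 / ((q k : ℝ) * q (k + 1)) := by
      rw [div_le_div_iff₀ (by positivity) (by positivity)]
      nlinarith
    have : 2 / ((q k : ℝ) * q (k + 1)) = 1 / ((q k : ℝ) * q (k + 1)) +
      1 / ((q k : ℝ) * q (k + 1)) := by ring
    linarith
  have htu : t ≤ u := fun k => by
    have := pos k
    have := pos (k + 1)
    have : 0 ≤ 2 / ((q k : ℝ) * q (k + 1)) := by positivity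
    simp only [t, u]
    linarith
  have hmem := Set.mem_iInter.1 (ht.ciSup_mem_iInter_Icc_of_antitone hu htu)
  refine ⟨⨆ k, t k, q, p, h0, h1, h2, h3, h4, fun k => ⟨-q (k + 1), p (k + 1), ?_⟩, fun k => ?_,
    fun k => ?_⟩
  · linear_combination h5 k
  · have := (hmem (k + 1)).1
    simp only [t, step k] at this ⊢
    linarith
  · have := (hmem k).2
    simp only [t, u] at this ⊢
    linarith

/-- A rational number either is far from `ξ` or is one of the convergents. -/
theorem abs_sub_ge_or_eq_convergent {ξ : ℝ} {q p : ℕ → ℤ} (h1 : ∀ k, 1 ≤ q k) (h0 : q 0 = 1)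
    (h4 : ∀ k, 2 * q k ≤ q (k + 1)) (hc : ∀ k, IsCoprime (p k) (q k))
    (hlo : ∀ k, 1 / ((q k : ℝ) * q (k + 1)) ≤ ξ - p k / q k)
    (hup : ∀ k, ξ - p k / q k ≤ 2 / ((q k : ℝ) * q (k + 1))) (a b : ℤ) (hb : 1 ≤ b) :
    1 / (8 * (b : ℝ) ^ 2) ≤ |ξ - a / b| ∨
      ∃ k, q k ≤ b ∧ 1 / ((q k : ℝ) * q (k + 1)) ≤ |ξ - a / b| := by
  have grow : ∀ k : ℕ, (k : ℤ) < q k := by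
    intro k
    induction k with
    | zero => have := h1 0; simp only [Nat.cast_zero]; omega
    | succ k ih => have := h4 k; have := h1 k; push_cast; omega
  have hex : ∃ k, 4 * b ≤ q (k + 1) := ⟨(4 * b).toNat, by
    have := grow ((4 * b).toNat + 1)
    push_cast at this
    omega⟩
  -- For this `k`, a fraction `a/b ≠ p_k/q_k` is at distance at least `1/(b q_k)` from `p_k/q_k`,
  -- while `ξ` is within half of that. The rest follows from `q_k ≤ 4b`.
  obtain ⟨k, hk, hmin⟩ : ∃ k, 4 * b ≤ q (k + 1) ∧ q k ≤ 4 * b := by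
    classical
    refine ⟨Nat.find hex, Nat.find_spec hex, ?_⟩
    rcases hN : Nat.find hex with _ | N
    · omega
    · have := Nat.find_min hex (m := N) (by omega)
      omega
  have bpos : (0 : ℝ) < b := by exact_mod_cast hb
  have qpos : (0 : ℝ) < q k := by exact_mod_cast h1 k
  have qpos' : (0 : ℝ) < q (k + 1) := by exact_mod_cast h1 (k + 1)
  by_cases heq : a * q k = p k * b
  · right
    refine ⟨k, ?_, ?_⟩
    · have : q k ∣ b := (hc k).symm.dvd_of_dvd_mul_left ⟨a, by rw [← heq]; ring⟩
      exact Int.le_of_dvd (by omega) this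
    · have : (a : ℝ) / b = p k / q k := by
        rw [div_eq_div_iff bpos.ne' qpos.ne']
        exact_mod_cast heq
      rw [this]
      exact (hlo k).trans (le_abs_self _)
  · left
    have h6 : (1 : ℝ) ≤ |(a : ℝ) * q k - p k * b| := by
      exact_mod_cast Int.one_le_abs (sub_ne_zero.2 heq)
    have h7 : 1 / ((b : ℝ) * q k) ≤ |(a : ℝ) / b - p k / q k| := by
      rw [div_sub_div _ _ bpos.ne' qpos.ne', abs_div, abs_of_pos (mul_pos bpos qpos)]
      gcongr
      rwa [mul_comm (b : ℝ)]
    have h8 : |ξ - p k / q k| ≤ 1 / (2 * ((b : ℝ) * q k)) := by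
      have hk' : 4 * (b : ℝ) ≤ q (k + 1) := by exact_mod_cast hk
      rw [abs_of_nonneg (le_trans (by positivity) (hlo k))]
      refine (hup k).trans ?_
      rw [div_le_div_iff₀ (by positivity) (by positivity)]
      nlinarith
    have h9 : |(a : ℝ) / b - p k / q k| ≤ |ξ - a / b| + |ξ - p k / q k| := by
      rw [abs_sub_comm ξ (a / b)]
      exact abs_sub_le _ _ _
    have h10 : 1 / (8 * (b : ℝ) ^ 2) ≤ 1 / (2 * ((b : ℝ) * q k)) := by
      have : (q k : ℝ) ≤ 4 * b := by exact_mod_cast hmin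
      apply one_div_le_one_div_of_le (by positivity)
      nlinarith
    have : 1 / ((b : ℝ) * q k) = 1 / (2 * ((b : ℝ) * q k)) + 1 / (2 * ((b : ℝ) * q k)) := by
      field_simp
      norm_num
    linarith

/-- Every real number `b ≥ 2` is the irrationality exponent of some real number. -/
theorem exists_liouvilleWith_iff_le {b : ℝ} (hb : 2 ≤ b) :
    ∃ ξ : ℝ, LiouvilleWith b ξ ∧ ∀ b', LiouvilleWith b' ξ → b' ≤ b := by
  have g_bd : ∀ x : ℤ, 1 ≤ x → ((max 1 ⌈(x : ℝ) ^ (b - 2)⌉ : ℤ) : ℝ) ≤ (x : ℝ) ^ (b - 2) + 1 := by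
    intro x hx
    have hx' : (1 : ℝ) ≤ x := by exact_mod_cast hx
    have := Real.rpow_nonneg (zero_le_one.trans hx') (b - 2)
    push_cast
    exact max_le (by linarith) (Int.ceil_lt_add_one _).le
  -- This growth makes `q_k q_{k+1}`, hence `1 / (ξ - p_k/q_k)`, comparable to `q_k ^ b`.
  obtain ⟨ξ, q, p, h0, h1, h2, h3, h4, hc, hlo, hup⟩ :=
    exists_real_of_growth (fun x => max 1 ⌈(x : ℝ) ^ (b - 2)⌉) (fun x => le_max_left _ _)
  have one_le : ∀ k, (1 : ℝ) ≤ q k := fun k => by exact_mod_cast h1 k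
  have pos : ∀ k, (0 : ℝ) < q k := fun k => zero_lt_one.trans_le (one_le k)
  have rpow_mul_self : ∀ k, (q k : ℝ) * ((q k : ℝ) ^ (b - 2) * q k) = (q k : ℝ) ^ b := by
    intro k
    have : (q k : ℝ) ^ b = (q k : ℝ) ^ (b - 2) * (q k : ℝ) ^ (2 : ℝ) := by
      rw [← Real.rpow_add (pos k)]
      congr 1
      ring
    rw [this, Real.rpow_two]
    ring
  have lower : ∀ k, (q k : ℝ) ^ b ≤ (q k : ℝ) * q (k + 1) := by
    intro k
    rw [← rpow_mul_self]
    refine mul_le_mul_of_nonneg_left ?_ (pos k).le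
    have h : ((max 1 ⌈(q k : ℝ) ^ (b - 2)⌉ : ℤ) : ℝ) * q k ≤ q (k + 1) := by exact_mod_cast h2 k
    refine le_trans (mul_le_mul_of_nonneg_right ?_ (pos k).le) h
    push_cast
    exact (Int.le_ceil _).trans (le_max_right _ _)
  have upper : ∀ k, (q k : ℝ) * q (k + 1) ≤ 4 * (q k : ℝ) ^ b := by
    intro k
    have h : (q (k + 1) : ℝ) ≤ (((max 1 ⌈(q k : ℝ) ^ (b - 2)⌉ : ℤ) : ℝ) + 2) * q k := by
      exact_mod_cast h3 k
    have h' := g_bd (q k) (h1 k)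
    have h'' : (1 : ℝ) ≤ (q k : ℝ) ^ (b - 2) := Real.one_le_rpow (one_le k) (by linarith)
    calc (q k : ℝ) * q (k + 1) ≤ q k * ((4 * (q k : ℝ) ^ (b - 2)) * q k) := by
          refine mul_le_mul_of_nonneg_left (h.trans ?_) (pos k).le
          exact mul_le_mul_of_nonneg_right (by linarith) (pos k).le
      _ = 4 * (q k : ℝ) ^ b := by rw [← rpow_mul_self]; ring
  have grow : ∀ k : ℕ, (k : ℤ) < q k := by
    intro k
    induction k with
    | zero => have := h1 0; simp only [Nat.cast_zero]; omega
    | succ k ih => have := h4 k; have := h1 k; push_cast; omega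
  refine ⟨ξ, ⟨3, Filter.frequently_atTop.2 fun N => ⟨(q N).toNat, ?_, p N, ?_, ?_⟩⟩, ?_⟩
  · have := grow N
    omega
  all_goals try
    have cast : (((q N).toNat : ℕ) : ℝ) = q N := by
      have : (((q N).toNat : ℕ) : ℤ) = q N := Int.toNat_of_nonneg (by have := h1 N; omega)
      exact_mod_cast this
    rw [cast]
  · intro h
    have := hlo N
    rw [h, sub_self] at this
    have h5 := pos N
    have h6 := pos (N + 1)
    exact absurd this (not_le.2 (by positivity))
  · have h5 := pos N
    have h6 := pos (N + 1)
    rw [abs_of_nonneg (le_trans (by positivity) (hlo N))]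
    have h7 := Real.rpow_pos_of_pos h5 b
    calc ξ - p N / q N ≤ 2 / ((q N : ℝ) * q (N + 1)) := hup N
      _ ≤ 2 / (q N : ℝ) ^ b := by gcongr; exact lower N
      _ < 3 / (q N : ℝ) ^ b := by gcongr; norm_num
  · intro b' h'
    by_contra! hlt
    -- Fractions that are not convergents are handled by `b ≥ 2`, convergents by `upper`.
    have key : ∀ n : ℕ, 1 ≤ n → ∀ m : ℤ, 1 / (8 * (n : ℝ) ^ b) ≤ |ξ - m / n| := by
      intro n hn m
      have hn' : (1 : ℝ) ≤ n := by exact_mod_cast hn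
      have hn0 : (0 : ℝ) < n := by linarith
      rcases abs_sub_ge_or_eq_convergent h1 h0 h4 hc hlo hup m n (by exact_mod_cast hn) with
        h | ⟨k, hk, h⟩
      · rw [Int.cast_natCast] at h
        refine le_trans ?_ h
        gcongr
        rw [← Real.rpow_two]
        exact Real.rpow_le_rpow_of_exponent_le hn' hb
      · rw [Int.cast_natCast] at h
        refine le_trans ?_ h
        have h5 := pos k
        have h6 := pos (k + 1)
        apply one_div_le_one_div_of_le (by positivity)
        have hk' : (q k : ℝ) ≤ n := by exact_mod_cast hk
        have h7 : (q k : ℝ) ^ b ≤ (n : ℝ) ^ b := Real.rpow_le_rpow h5.le hk' (by linarith)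
        have h8 := upper k
        have h9 := Real.rpow_pos_of_pos h5 b
        linarith
    have ev : ∀ᶠ n : ℕ in Filter.atTop, (8 : ℝ) < (n : ℝ) ^ ((b' - b) / 2) :=
      ((tendsto_rpow_atTop (by linarith)).comp tendsto_natCast_atTop_atTop).eventually
        (Filter.eventually_gt_atTop 8)
    have fr := h'.frequently_lt_rpow_neg (q := (b' + b) / 2) (by linarith)
    obtain ⟨n, ⟨h8, hn⟩, m, -, hm⟩ :=
      ((ev.and (Filter.eventually_ge_atTop 1)).and_frequently fr).exists
    have hn0 : (0 : ℝ) < n := by exact_mod_cast hn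
    have h5 := (key n hn m).trans_lt hm
    have h6 : (n : ℝ) ^ ((b' + b) / 2) = (n : ℝ) ^ b * (n : ℝ) ^ ((b' - b) / 2) := by
      rw [← Real.rpow_add hn0]
      congr 1
      ring
    have h7 := Real.rpow_pos_of_pos hn0 b
    rw [Real.rpow_neg hn0.le, h6, ← one_div, one_div_lt_one_div (by positivity) (by positivity)]
      at h5
    nlinarith

noncomputable section

namespace SubspaceApprox

open Module

variable {n : ℕ}

/-! ### Canonical angles and distances -/

theorem psi_nonneg (X Y : EuclideanSpace ℝ (Fin n)) : 0 ≤ psi X Y :=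
  InnerProductGeometry.sin_angle_nonneg X Y

/-- The left side is the distance from `X` to the line spanned by `Y`. -/
theorem psi_mul_norm_le (X Y : EuclideanSpace ℝ (Fin n)) : psi X Y * ‖X‖ ≤ ‖X - Y‖ := by
  refine le_of_sq_le_sq ?_ (norm_nonneg _)
  have h :=
    InnerProductGeometry.norm_sub_sq_eq_norm_sq_add_norm_sq_sub_two_mul_norm_mul_norm_mul_cos_angle
      X Y
  have h' := Real.sin_sq_add_cos_sq (InnerProductGeometry.angle X Y)
  have h'' : (psi X Y * ‖X‖) ^ 2 =
      ‖X‖ ^ 2 - (‖X‖ * Real.cos (InnerProductGeometry.angle X Y)) ^ 2 := by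
    rw [psi]
    linear_combination ‖X‖ ^ 2 * h'
  nlinarith [sq_nonneg (‖Y‖ - ‖X‖ * Real.cos (InnerProductGeometry.angle X Y))]

theorem norm_sub_inner_smul_eq_psi {X Y : EuclideanSpace ℝ (Fin n)} (hX : ‖X‖ = 1)
    (hY : ‖Y‖ = 1) : ‖X - (inner ℝ X Y : ℝ) • Y‖ = psi X Y := by
  refine (sq_eq_sq₀ (norm_nonneg _) (psi_nonneg X Y)).1 ?_
  have h : Real.cos (InnerProductGeometry.angle X Y) = inner ℝ X Y := by
    rw [InnerProductGeometry.cos_angle, hX, hY, mul_one, div_one]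
  rw [psi, Real.sin_sq, h, norm_sub_sq_real, real_inner_smul_right, norm_smul, hX, hY,
    Real.norm_eq_abs, mul_one, sq_abs]
  ring

namespace IsAngleSystem

variable {A B : Submodule ℝ (EuclideanSpace ℝ (Fin n))} {m : ℕ}
  {X Y : ℕ → EuclideanSpace ℝ (Fin n)}

theorem orthonormal_left (h : IsAngleSystem A B m X Y) :
    Orthonormal ℝ (fun i : Fin m => X i) := by
  refine ⟨fun i => (h i i.2).norm_left, ?_⟩
  have key : ∀ i j : Fin m, i < j → inner ℝ (X i) (X j) = 0 := fun i j hij =>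
    (h j j.2).left_mem.2 _ (Submodule.subset_span ⟨i, hij, rfl⟩)
  intro i j hij
  rcases lt_or_gt_of_ne hij with hij | hij
  · exact key i j hij
  · rw [real_inner_comm]
    exact key j i hij

theorem span_left (h : IsAngleSystem A B m X Y) (hA : finrank ℝ A = m) :
    Submodule.span ℝ (Set.range fun i : Fin m => X i) = A := by
  apply Submodule.eq_of_le_of_finrank_eq
  · rw [Submodule.span_le]
    rintro _ ⟨i, rfl⟩
    exact (h i i.2).left_mem.1
  · rw [finrank_span_eq_card h.orthonormal_left.linearIndependent, Fintype.card_fin, hA]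

/-- A later pair is an admissible competitor in every earlier minimization. -/
theorem psi_le_psi (h : IsAngleSystem A B m X Y) {i j : ℕ} (hij : i ≤ j) (hj : j < m) :
    psi (X i) (Y i) ≤ psi (X j) (Y j) := by
  have mono : ∀ (C : Submodule ℝ (EuclideanSpace ℝ (Fin n))) (Z : ℕ → EuclideanSpace ℝ (Fin n)),
      C ⊓ (Submodule.span ℝ (Z '' Set.Iio j))ᗮ ≤ C ⊓ (Submodule.span ℝ (Z '' Set.Iio i))ᗮ :=
    fun C Z => inf_le_inf_left _ (Submodule.orthogonal_le
      (Submodule.span_mono (Set.image_mono (Set.Iio_subset_Iio hij))))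
  have hj' := h j hj
  refine (h i (hij.trans_lt hj)).psi_le _ (mono _ _ hj'.left_mem) _ (mono _ _ hj'.right_mem) ?_ ?_
  · exact norm_ne_zero_iff.1 (by rw [hj'.norm_left]; exact one_ne_zero)
  · exact norm_ne_zero_iff.1 (by rw [hj'.norm_right]; exact one_ne_zero)

/-- Each `X i` is replaced by its projection on the line of `Y i`, at a cost of `psi (X i) (Y i)`;
the factor `m` comes from the triangle inequality. -/
theorem exists_norm_sub_le (h : IsAngleSystem A B m X Y) (hA : finrank ℝ A = m)
    {x : EuclideanSpace ℝ (Fin n)} (hx : x ∈ A) :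
    ∃ y ∈ B, ‖x - y‖ ≤ m * psi (X (m - 1)) (Y (m - 1)) * ‖x‖ := by
  rw [← h.span_left hA, Submodule.mem_span_range_iff_exists_fun] at hx
  obtain ⟨c, rfl⟩ := hx
  set x := ∑ i : Fin m, c i • X i
  have hc : ∀ i, |c i| ≤ ‖x‖ := by
    intro i
    have h1 : inner ℝ (X i) x = c i := h.orthonormal_left.inner_right_fintype c i
    have h2 := abs_real_inner_le_norm (X i) x
    rwa [h1, (h i i.2).norm_left, one_mul] at h2
  refine ⟨∑ i : Fin m, c i • ((inner ℝ (X i) (Y i) : ℝ) • Y i), Submodule.sum_mem _ fun i _ =>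
    Submodule.smul_mem _ _ (Submodule.smul_mem _ _ (h i i.2).right_mem.1), ?_⟩
  rw [← Finset.sum_sub_distrib]
  refine (norm_sum_le _ _).trans ?_
  have : ∀ i ∈ (Finset.univ : Finset (Fin m)),
      ‖c i • X i - c i • ((inner ℝ (X i) (Y i) : ℝ) • Y i)‖ ≤
        psi (X (m - 1)) (Y (m - 1)) * ‖x‖ := by
    intro i _
    rw [← smul_sub, norm_smul, norm_sub_inner_smul_eq_psi (h i i.2).norm_left (h i i.2).norm_right,
      mul_comm]
    have hi : (i : ℕ) ≤ m - 1 := Nat.le_sub_one_of_lt i.2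
    exact mul_le_mul (h.psi_le_psi hi (by have := i.2; omega)) (hc i) (abs_nonneg _) (psi_nonneg _ _)
  refine (Finset.sum_le_sum this).trans ?_
  rw [Finset.sum_const, Finset.card_univ, Fintype.card_fin, nsmul_eq_mul, mul_assoc]

end IsAngleSystem

theorem exists_norm_sub_le_of_angleSine_lt {A B : Submodule ℝ (EuclideanSpace ℝ (Fin n))} {m : ℕ}
    (hA : finrank ℝ A = m) (hB : finrank ℝ B = m) {r : ℝ} (hr : angleSine A B m < r)
    {x : EuclideanSpace ℝ (Fin n)} (hx : x ∈ A) : ∃ y ∈ B, ‖x - y‖ ≤ m * r * ‖x‖ := by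
  obtain ⟨_, ⟨X, Y, h, rfl⟩, hlt⟩ :=
    exists_lt_of_csInf_lt (angleSineValues_nonempty A B m hA.ge hB.ge) hr
  obtain ⟨y, hy, hxy⟩ := h.exists_norm_sub_le hA hx
  exact ⟨y, hy, hxy.trans (by gcongr)⟩

theorem angleSine_le {A B : Submodule ℝ (EuclideanSpace ℝ (Fin n))} {m : ℕ}
    {X Y : ℕ → EuclideanSpace ℝ (Fin n)} (h : IsAngleSystem A B m X Y) :
    angleSine A B m ≤ psi (X (m - 1)) (Y (m - 1)) :=
  csInf_le ⟨0, by rintro _ ⟨X, Y, -, rfl⟩; exact psi_nonneg _ _⟩ ⟨X, Y, h, rfl⟩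

/-! ### Plücker coordinates determine the subspace -/

/-- The determinant of the matrix formed by the coordinates with indices `f 0, …, f (e - 1)` of
`e` vectors. -/
def rowMinor {e : ℕ} (f : Fin e → Fin n) (v : Fin e → EuclideanSpace ℝ (Fin n)) : ℝ :=
  (Matrix.of fun i j => v j (f i)).det

theorem rowMinor_comp_perm {e : ℕ} (f : Fin e → Fin n) (v : Fin e → EuclideanSpace ℝ (Fin n))
    (σ : Equiv.Perm (Fin e)) :
    rowMinor (f ∘ σ) v = ((Equiv.Perm.sign σ : ℤ) : ℝ) * rowMinor f v :=
  Matrix.det_permute σ (Matrix.of fun i j => v j (f i))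

/-- Cramer's rule replaces one row index by another, which destroys monotonicity. Sorting costs a
sign common to both sides, and a repeated index gives zero. -/
theorem rowMinor_eq_mul_of_maximalMinors_eq {e : ℕ} {v w : Fin e → EuclideanSpace ℝ (Fin n)}
    {c : ℝ} (h : maximalMinors v = c • maximalMinors w) (f : Fin e → Fin n) :
    rowMinor f v = c * rowMinor f w := by
  by_cases hf : Function.Injective f
  · let I : Fin e ↪o Fin n := OrderEmbedding.ofStrictMono (f ∘ Tuple.sort f)
      ((Tuple.monotone_sort f).strictMono_of_injective (hf.comp (Tuple.sort f).injective))
    have h' : rowMinor (f ∘ Tuple.sort f) v = c * rowMinor (f ∘ Tuple.sort f) w := congrFun h I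
    rw [rowMinor_comp_perm, rowMinor_comp_perm, mul_left_comm] at h'
    refine mul_left_cancel₀ ?_ h'
    rcases Int.units_eq_one_or (Equiv.Perm.sign (Tuple.sort f)) with hs | hs <;> simp [hs]
  · simp only [Function.Injective, not_forall] at hf
    obtain ⟨i, j, hij, hne⟩ := hf
    have zero : ∀ u : Fin e → EuclideanSpace ℝ (Fin n), rowMinor f u = 0 := fun u =>
      Matrix.det_zero_of_row_eq hne (by ext k; simp [hij])
    rw [zero, zero, mul_zero]

/-- Cramer's rule: the coordinates of a vector of the span of `v` are determined by its coordinates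
with indices in the range of `f`, if the corresponding minor is nonzero. -/
theorem coord_mul_rowMinor {e : ℕ} (f : Fin e → Fin n) {v : Fin e → EuclideanSpace ℝ (Fin n)}
    {x : EuclideanSpace ℝ (Fin n)} (hx : x ∈ Submodule.span ℝ (Set.range v)) (k : Fin n) :
    x k * rowMinor f v = ∑ j, x (f j) * rowMinor (Function.update f j k) v := by
  have basis : ∀ m, v m k * rowMinor f v =
      ∑ j, v m (f j) * rowMinor (Function.update f j k) v := by
    intro m
    let M : Matrix (Fin e) (Fin e) ℝ := Matrix.of fun i j => v j (f i)
    have h := congrFun (Matrix.mulVec_cramer M.transpose fun j => v j k) m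
    have h' : ∀ j, Matrix.cramer M.transpose (fun j => v j k) j =
        rowMinor (Function.update f j k) v := by
      intro j
      rw [Matrix.cramer_transpose_apply, rowMinor]
      congr 1
      ext a b
      by_cases hab : a = j
      · subst hab
        simp
      · simp [Matrix.updateRow_ne hab, Function.update_of_ne hab, M]
    rw [Matrix.det_transpose] at h
    simp only [Matrix.mulVec, dotProduct, h', Matrix.transpose_apply, Pi.smul_apply,
      smul_eq_mul] at h
    rw [mul_comm, rowMinor]
    exact h.symm
  rw [Submodule.mem_span_range_iff_exists_fun] at hx
  obtain ⟨c, rfl⟩ := hx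
  simp only [WithLp.ofLp_sum, WithLp.ofLp_smul, Finset.sum_apply, Pi.smul_apply, smul_eq_mul,
    Finset.sum_mul]
  rw [Finset.sum_comm]
  refine Finset.sum_congr rfl fun m _ => ?_
  rw [mul_assoc, basis m, Finset.mul_sum]
  exact Finset.sum_congr rfl fun j _ => by ring

theorem exists_maximalMinors_ne_zero {e : ℕ} {v : Fin e → EuclideanSpace ℝ (Fin n)}
    (hv : LinearIndependent ℝ v) : ∃ I, maximalMinors v I ≠ 0 := by
  let M : Matrix (Fin e) (Fin n) ℝ := Matrix.of fun j k => v j k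
  have hM : LinearIndependent ℝ M.row :=
    hv.map' (WithLp.linearEquiv 2 ℝ (Fin n → ℝ)).toLinearMap (LinearEquiv.ker _)
  have hrank : finrank ℝ (Submodule.span ℝ (Set.range M.col)) = e := by
    rw [← Matrix.rank_eq_finrank_span_cols, hM.rank_matrix, Fintype.card_fin]
  obtain ⟨κ, a, ha, hspan, hli⟩ := exists_linearIndependent' ℝ M.col
  have : Finite κ := Finite.of_injective a ha
  have := Fintype.ofFinite κ
  have hκ : Fintype.card κ = e := by
    rw [← finrank_span_eq_card hli, hspan, hrank]
  let σ : Fin e ≃ κ := (Fintype.equivFinOfCardEq hκ).symm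
  have hne : rowMinor (a ∘ σ) v ≠ 0 := by
    have h := (Matrix.linearIndependent_rows_iff_isUnit
      (A := Matrix.of fun i j => v j ((a ∘ σ) i))).1 (hli.comp σ σ.injective)
    exact ((Matrix.isUnit_iff_isUnit_det _).1 h).ne_zero
  by_contra! h
  refine hne ?_
  have := rowMinor_eq_mul_of_maximalMinors_eq (v := v) (w := v) (c := 0)
    (by ext I; simp [h I]) (a ∘ σ)
  simpa using this

/-- Choose `u` in the span of `w` with the coordinates of `x` on a set of rows where the minor of
`w` is nonzero. By Cramer's rule ratios of minors give the other coordinates, and these ratios agree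
for `v` and `w`. -/
theorem span_le_of_maximalMinors_eq {e : ℕ} {v w : Fin e → EuclideanSpace ℝ (Fin n)} {c : ℝ}
    (hw : LinearIndependent ℝ w) (hc : c ≠ 0) (h : maximalMinors v = c • maximalMinors w) :
    Submodule.span ℝ (Set.range v) ≤ Submodule.span ℝ (Set.range w) := by
  intro x hx
  obtain ⟨I, hI⟩ := exists_maximalMinors_ne_zero hw
  let M : Matrix (Fin e) (Fin e) ℝ := Matrix.of fun i j => w j (I i)
  have hdet : IsUnit M.det := isUnit_iff_ne_zero.2 hI
  let b : Fin e → ℝ := M⁻¹.mulVec fun i => x (I i)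
  have hb : ∀ i, ∑ j, w j (I i) * b j = x (I i) := by
    have : M.mulVec b = fun i => x (I i) := by
      rw [Matrix.mulVec_mulVec, Matrix.mul_nonsing_inv _ hdet, Matrix.one_mulVec]
    exact fun i => congrFun this i
  let u : EuclideanSpace ℝ (Fin n) := ∑ j, b j • w j
  have hu : u ∈ Submodule.span ℝ (Set.range w) :=
    Submodule.sum_mem _ fun j _ => Submodule.smul_mem _ _ (Submodule.subset_span ⟨j, rfl⟩)
  have hux : ∀ i, u (I i) = x (I i) := by
    intro i
    rw [← hb i]
    simp [u, mul_comm]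
  suffices x = u by rwa [this]
  ext k
  have h1 := coord_mul_rowMinor I hx k
  have h2 := coord_mul_rowMinor I hu k
  simp only [rowMinor_eq_mul_of_maximalMinors_eq h, mul_left_comm _ c, ← Finset.mul_sum] at h1
  simp only [hux, ← mul_left_cancel₀ hc h1] at h2
  exact (mul_right_cancel₀ hI h2).symm

theorem IsPluckerRepresentative.eq {e : ℕ} {B C : Submodule ℝ (EuclideanSpace ℝ (Fin n))}
    {Ξ : (Fin e ↪o Fin n) → ℝ} (hB : IsPluckerRepresentative B Ξ)
    (hC : IsPluckerRepresentative C Ξ) : B = C := by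
  obtain ⟨v, hv, rfl, c, hc, hΞ⟩ := hB
  obtain ⟨w, hw, rfl, d, hd, hΞ'⟩ := hC
  have h1 : maximalMinors v = (c⁻¹ * d) • maximalMinors w := by
    rw [mul_smul, ← hΞ', hΞ, inv_smul_smul₀ hc]
  have h2 : maximalMinors w = (d⁻¹ * c) • maximalMinors v := by
    rw [mul_smul, ← hΞ, hΞ', inv_smul_smul₀ hd]
  exact le_antisymm (span_le_of_maximalMinors_eq hw (mul_ne_zero (inv_ne_zero hc) hd) h1)
    (span_le_of_maximalMinors_eq hv (mul_ne_zero (inv_ne_zero hd) hc) h2)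

theorem IsPluckerRepresentative.smul {e : ℕ} {B : Submodule ℝ (EuclideanSpace ℝ (Fin n))}
    {Ξ : (Fin e ↪o Fin n) → ℝ} (h : IsPluckerRepresentative B Ξ) {c : ℝ} (hc : c ≠ 0) :
    IsPluckerRepresentative B (c • Ξ) := by
  obtain ⟨v, hv, hB, d, hd, rfl⟩ := h
  exact ⟨v, hv, hB, c * d, mul_ne_zero hc hd, smul_smul _ _ _⟩

theorem IsPluckerRepresentative.exists_ne_zero {e : ℕ}
    {B : Submodule ℝ (EuclideanSpace ℝ (Fin n))} {Ξ : (Fin e ↪o Fin n) → ℝ}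
    (h : IsPluckerRepresentative B Ξ) : ∃ I, Ξ I ≠ 0 := by
  obtain ⟨v, hv, -, d, hd, rfl⟩ := h
  obtain ⟨I, hI⟩ := exists_maximalMinors_ne_zero hv
  exact ⟨I, mul_ne_zero hd hI⟩

/-! ### Heights and the Northcott property -/

theorem exists_coprime_representative {e : ℕ} {B : Submodule ℝ (EuclideanSpace ℝ (Fin n))}
    {z : (Fin e ↪o Fin n) → ℤ} (h : IsPluckerRepresentative B fun I => (z I : ℝ)) :
    ∃ z' : (Fin e ↪o Fin n) → ℤ, Finset.univ.gcd z' = 1 ∧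
      IsPluckerRepresentative B (fun I => (z' I : ℝ)) ∧ ∀ I, |z' I| ≤ |z I| := by
  obtain ⟨I₀, hI₀⟩ := h.exists_ne_zero
  obtain ⟨z', hz', hgcd⟩ := Finset.extract_gcd z ⟨I₀, Finset.mem_univ I₀⟩
  set g := Finset.univ.gcd z
  have hg : g ≠ 0 := by
    intro hg
    apply hI₀
    rw [hz' I₀ (Finset.mem_univ _), hg, zero_mul, Int.cast_zero]
  refine ⟨z', hgcd, ?_, fun I => ?_⟩
  · have hg' : (g : ℝ) ≠ 0 := by exact_mod_cast hg
    convert h.smul (inv_ne_zero hg') using 1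
    ext I
    rw [Pi.smul_apply, hz' I (Finset.mem_univ _), Int.cast_mul, smul_eq_mul,
      inv_mul_cancel_left₀ hg']
  · rw [hz' I (Finset.mem_univ _), abs_mul]
    exact le_mul_of_one_le_left (abs_nonneg _) (Int.one_le_abs hg)

theorem height_le {e : ℕ} {B : Submodule ℝ (EuclideanSpace ℝ (Fin n))}
    {z : (Fin e ↪o Fin n) → ℤ} (h : IsPluckerRepresentative B fun I => (z I : ℝ)) :
    height e B ≤ √(∑ I, (z I : ℝ) ^ 2) := by
  obtain ⟨z', hgcd, hrep, hle⟩ := exists_coprime_representative h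
  have h1 : height e B ≤ √(∑ I, (z' I : ℝ) ^ 2) := by
    refine csInf_le ⟨0, ?_⟩ ⟨z', hgcd, hrep, rfl⟩
    rintro _ ⟨z, -, -, rfl⟩
    exact Real.sqrt_nonneg _
  refine h1.trans (Real.sqrt_le_sqrt (Finset.sum_le_sum fun I _ => sq_le_sq.2 ?_))
  exact_mod_cast hle I

theorem abs_le_sqrt_sum_sq {ι : Type*} [Fintype ι] (f : ι → ℝ) (i : ι) :
    |f i| ≤ √(∑ j, f j ^ 2) :=
  Real.abs_le_sqrt (Finset.single_le_sum (f := fun j => f j ^ 2) (fun _ _ => sq_nonneg _)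
    (Finset.mem_univ i))

theorem exists_integer_representative {e : ℕ} {B : Submodule ℝ (EuclideanSpace ℝ (Fin n))}
    (hB : B ∈ rationalSubspaces n e) :
    ∃ z : (Fin e ↪o Fin n) → ℤ, IsPluckerRepresentative B fun I => (z I : ℝ) := by
  obtain ⟨rfl, b, hb⟩ := hB
  choose q hq using hb
  let r : (Fin (finrank ℝ B) ↪o Fin n) → ℚ := fun I => (Matrix.of fun i j => q j (I i)).det
  obtain ⟨d, hd⟩ := IsLocalization.exist_integer_multiples_of_finite (nonZeroDivisors ℤ) r
  choose z hz using hd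
  have hd0 : ((d : ℤ) : ℝ) ≠ 0 := by exact_mod_cast nonZeroDivisors.coe_ne_zero d
  refine ⟨z, fun i => b i, b.linearIndependent.map' B.subtype B.ker_subtype, ?_, (d : ℤ), hd0, ?_⟩
  · have : (Set.range fun i => (b i : EuclideanSpace ℝ (Fin n))) = B.subtype '' Set.range b := by
      rw [← Set.range_comp]
      rfl
    rw [this, Submodule.span_image, b.span_eq, Submodule.map_top, Submodule.range_subtype]
  · ext I
    have h1 : maximalMinors (fun i => (b i : EuclideanSpace ℝ (Fin n))) I = (r I : ℝ) := by
      have h3 := RingHom.map_det (algebraMap ℚ ℝ) (Matrix.of fun i j => q j (I i))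
      refine Eq.trans ?_ h3.symm
      unfold maximalMinors
      congr 1
      ext i j
      simp [hq]
    have h2 : (z I : ℚ) = (d : ℤ) * r I := by
      have := hz I
      simpa using this
    rw [Pi.smul_apply, h1, smul_eq_mul]
    exact_mod_cast h2

theorem one_le_sqrt_sum_sq {e : ℕ} {z : (Fin e ↪o Fin n) → ℤ} (hz : Finset.univ.gcd z = 1) :
    1 ≤ √(∑ I, (z I : ℝ) ^ 2) := by
  obtain ⟨I, hI⟩ : ∃ I, z I ≠ 0 := by
    by_contra! h
    rw [Finset.gcd_eq_zero_iff.2 fun I _ => h I] at hz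
    exact zero_ne_one hz
  refine le_trans ?_ (abs_le_sqrt_sum_sq (fun I => (z I : ℝ)) I)
  exact_mod_cast Int.one_le_abs hI

theorem height_set_nonempty {e : ℕ} {B : Submodule ℝ (EuclideanSpace ℝ (Fin n))}
    (hB : B ∈ rationalSubspaces n e) :
    {h : ℝ | ∃ z : (Fin e ↪o Fin n) → ℤ, Finset.univ.gcd z = 1 ∧
      IsPluckerRepresentative B (fun I => (z I : ℝ)) ∧ h = √(∑ I, (z I : ℝ) ^ 2)}.Nonempty := by
  obtain ⟨z, hz⟩ := exists_integer_representative hB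
  obtain ⟨z', hgcd, hrep, -⟩ := exists_coprime_representative hz
  exact ⟨_, z', hgcd, hrep, rfl⟩

theorem one_le_height {e : ℕ} {B : Submodule ℝ (EuclideanSpace ℝ (Fin n))}
    (hB : B ∈ rationalSubspaces n e) : 1 ≤ height e B := by
  refine le_csInf (height_set_nonempty hB) ?_
  rintro _ ⟨z, hz, -, rfl⟩
  exact one_le_sqrt_sum_sq hz

/-- The slack `1` avoids proving that the infimum defining the height is over a single value; it is
harmless because heights are at least `1`. -/
theorem exists_representative_lt {e : ℕ} {B : Submodule ℝ (EuclideanSpace ℝ (Fin n))}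
    (hB : B ∈ rationalSubspaces n e) :
    ∃ z : (Fin e ↪o Fin n) → ℤ, IsPluckerRepresentative B (fun I => (z I : ℝ)) ∧
      √(∑ I, (z I : ℝ) ^ 2) < height e B + 1 := by
  obtain ⟨_, ⟨z, -, hrep, rfl⟩, hlt⟩ :=
    exists_lt_of_csInf_lt (height_set_nonempty hB) (lt_add_one (height e B))
  exact ⟨z, hrep, hlt⟩

/-- Northcott property: there are finitely many rational subspaces of bounded height. -/
theorem finite_height_le (n e : ℕ) (K : ℝ) :
    {B | B ∈ rationalSubspaces n e ∧ height e B ≤ K}.Finite := by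
  have key : ∀ B ∈ {B | B ∈ rationalSubspaces n e ∧ height e B ≤ K},
      ∃ z ∈ Set.Icc (fun _ => -⌈K + 1⌉) (fun _ => ⌈K + 1⌉),
        IsPluckerRepresentative B fun I : Fin e ↪o Fin n => ((z I : ℤ) : ℝ) := by
    rintro B ⟨hB, hK⟩
    obtain ⟨z, hrep, hlt⟩ := exists_representative_lt hB
    have : ∀ I, |z I| ≤ ⌈K + 1⌉ := by
      intro I
      have h1 := (abs_le_sqrt_sum_sq (fun I => (z I : ℝ)) I).trans hlt.le
      have h2 : ((|z I| : ℤ) : ℝ) ≤ ⌈K + 1⌉ := by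
        push_cast
        linarith [Int.le_ceil (K + 1)]
      exact_mod_cast h2
    exact ⟨z, ⟨fun I => (abs_le.1 (this I)).1, fun I => (abs_le.1 (this I)).2⟩, hrep⟩
  choose! z hz hrep using key
  refine Set.Finite.of_injOn (f := z) hz (fun B hB C hC h => ?_) (Set.finite_Icc _ _)
  exact (hrep B hB).eq (by rw [h]; exact hrep C hC)

/-! ### Minors under change of basis and perturbation -/

theorem linearIndependent_of_rowMinor_ne_zero {e : ℕ} {f : Fin e → Fin n}
    {v : Fin e → EuclideanSpace ℝ (Fin n)} (h : rowMinor f v ≠ 0) : LinearIndependent ℝ v := by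
  have h' := (Matrix.linearIndependent_cols_iff_isUnit (A := Matrix.of fun i j => v j (f i))).2
    ((Matrix.isUnit_iff_isUnit_det _).2 (isUnit_iff_ne_zero.2 h))
  exact LinearIndependent.of_comp
    (LinearMap.funLeft ℝ ℝ f ∘ₗ (WithLp.linearEquiv 2 ℝ (Fin n → ℝ)).toLinearMap) h'

/-- A change of basis multiplies all maximal minors by its determinant. -/
theorem IsPluckerRepresentative.exists_eq_smul {e : ℕ}
    {B : Submodule ℝ (EuclideanSpace ℝ (Fin n))} {Ξ : (Fin e ↪o Fin n) → ℝ}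
    (h : IsPluckerRepresentative B Ξ) {v : Fin e → EuclideanSpace ℝ (Fin n)}
    (hv : B ≤ Submodule.span ℝ (Set.range v)) : ∃ c : ℝ, Ξ = c • maximalMinors v := by
  obtain ⟨w, -, rfl, c, -, rfl⟩ := h
  have hw : ∀ j, ∃ P : Fin e → ℝ, ∑ k, P k • v k = w j := fun j =>
    (Submodule.mem_span_range_iff_exists_fun ℝ).1 (hv (Submodule.subset_span ⟨j, rfl⟩))
  choose P hP using hw
  refine ⟨c * (Matrix.of fun k j => P j k).det, ?_⟩
  rw [mul_smul]
  congr 1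
  ext I
  rw [Pi.smul_apply, smul_eq_mul, mul_comm]
  simp only [maximalMinors]
  rw [← Matrix.det_mul]
  congr 1
  ext i j
  simp [Matrix.mul_apply, ← hP j, mul_comm]

theorem sqrt_sum_sq_le {ι : Type*} [Fintype ι] {f : ι → ℝ} {M : ℝ} (hM : 0 ≤ M)
    (h : ∀ i, |f i| ≤ M) : √(∑ i, f i ^ 2) ≤ √(Fintype.card ι) * M := by
  rw [← Real.sqrt_sq hM, ← Real.sqrt_mul (Nat.cast_nonneg _)]
  apply Real.sqrt_le_sqrt
  calc ∑ i, f i ^ 2 ≤ ∑ _i : ι, M ^ 2 :=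
        Finset.sum_le_sum fun i _ => sq_le_sq.2 (by rw [abs_of_nonneg hM]; exact h i)
    _ = Fintype.card ι * M ^ 2 := by simp

theorem differentiable_maximalMinors (n e : ℕ) :
    Differentiable ℝ
      (maximalMinors : (Fin e → EuclideanSpace ℝ (Fin n)) → (Fin e ↪o Fin n) → ℝ) := by
  refine differentiable_pi.2 fun I => ?_
  simp only [maximalMinors, Matrix.det_apply, Matrix.of_apply]
  fun_prop

theorem exists_norm_maximalMinors_sub_le {e : ℕ} (a : Fin e → EuclideanSpace ℝ (Fin n)) :
    ∃ C > 0, ∃ δ > 0, ∀ b : Fin e → EuclideanSpace ℝ (Fin n), ‖b - a‖ < δ →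
      ‖maximalMinors b - maximalMinors a‖ ≤ C * ‖b - a‖ := by
  obtain ⟨C, hC, h⟩ := ((differentiable_maximalMinors n e) a).isBigO_sub.exists_pos
  obtain ⟨δ, hδ, h'⟩ := Metric.eventually_nhds_iff.1 h.bound
  exact ⟨C, hC, δ, hδ, fun b hb => h' (by rwa [dist_eq_norm])⟩

/-! ### The one-parameter family of subspaces, with `ℓ = m + 1` -/

variable {m : ℕ}

/-- The index `m + 1` of a coordinate of `ℝⁿ`. -/
def lastIndex (hm : m + 2 ≤ n) : Fin n := ⟨m + 1, by omega⟩

/-- The basis `e_0, …, e_{m-1}, e_m + t e_{m+1}` of `pencil hm t`. -/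
def pencilBasis (hm : m + 2 ≤ n) (t : ℝ) (j : Fin (m + 1)) : EuclideanSpace ℝ (Fin n) :=
  EuclideanSpace.single (Fin.castLE (by omega) j) 1 +
    (if j = Fin.last m then t else 0) • EuclideanSpace.single (lastIndex hm) 1

/-- The subspace spanned by `e_0, …, e_{m-1}, e_m + t e_{m+1}`. -/
def pencil (hm : m + 2 ≤ n) (t : ℝ) : Submodule ℝ (EuclideanSpace ℝ (Fin n)) :=
  Submodule.span ℝ (Set.range (pencilBasis hm t))

section Pencil

variable (hm : m + 2 ≤ n)

theorem pencilBasis_apply (t : ℝ) (j : Fin (m + 1)) (k : Fin n) :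
    pencilBasis hm t j k = (if k = Fin.castLE (by omega) j then 1 else 0) +
      (if j = Fin.last m then t else 0) * (if k = lastIndex hm then 1 else 0) := by
  by_cases hj : j = Fin.last m <;> simp [pencilBasis, hj]

theorem castLE_ne_lastIndex (i : Fin (m + 1)) :
    Fin.castLE (by omega : m + 1 ≤ n) i ≠ lastIndex hm := by
  intro h
  have := congrArg Fin.val h
  simp only [Fin.val_castLE, lastIndex] at this
  omega

theorem pencilBasis_castLE (t : ℝ) (i j : Fin (m + 1)) :
    pencilBasis hm t j (Fin.castLE (by omega) i) = if i = j then 1 else 0 := by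
  simp [pencilBasis_apply, castLE_ne_lastIndex]

theorem pencilBasis_lastIndex (t : ℝ) (j : Fin (m + 1)) :
    pencilBasis hm t j (lastIndex hm) = if j = Fin.last m then t else 0 := by
  simp [pencilBasis_apply, (castLE_ne_lastIndex hm j).symm]

/-- The rows `0, …, m`. -/
def firstRows : Fin (m + 1) ↪o Fin n := Fin.castLEOrderEmb (by omega)

/-- The rows `0, …, m - 1, m + 1`. -/
def secondRows : Fin (m + 1) ↪o Fin n :=
  OrderEmbedding.ofStrictMono
    (fun i => if i = Fin.last m then lastIndex hm else Fin.castLE (by omega) i) <| by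
    intro i j hij
    have hi : i ≠ Fin.last m := ne_of_lt (hij.trans_le (Fin.le_last j))
    simp only [if_neg hi, Fin.lt_def]
    split_ifs with hj
    · have := i.2
      simp only [Fin.val_castLE, lastIndex]
      omega
    · exact hij

theorem maximalMinors_pencilBasis_firstRows (t : ℝ) :
    maximalMinors (pencilBasis hm t) (firstRows hm) = 1 := by
  have : (Matrix.of fun i j => pencilBasis hm t j (firstRows hm i)) = 1 := by
    ext i j
    rw [Matrix.one_apply, Matrix.of_apply]
    exact pencilBasis_castLE hm t i j
  rw [maximalMinors, this, Matrix.det_one]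

theorem maximalMinors_pencilBasis_secondRows (t : ℝ) :
    maximalMinors (pencilBasis hm t) (secondRows hm) = t := by
  have : (Matrix.of fun i j => pencilBasis hm t j (secondRows hm i)) =
      Matrix.diagonal fun i => if i = Fin.last m then t else 1 := by
    ext i j
    rw [Matrix.diagonal_apply, Matrix.of_apply]
    by_cases hi : i = Fin.last m
    · subst hi
      have : secondRows hm (Fin.last m) = lastIndex hm := if_pos rfl
      rw [this, pencilBasis_lastIndex]
      simp [eq_comm]
    · have : secondRows hm i = Fin.castLE (by omega) i := if_neg hi
      rw [this, pencilBasis_castLE, if_neg hi]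
  rw [maximalMinors, this, Matrix.det_diagonal]
  simp

theorem linearIndependent_pencilBasis (t : ℝ) : LinearIndependent ℝ (pencilBasis hm t) :=
  linearIndependent_of_rowMinor_ne_zero (f := firstRows hm) <| by
    rw [show rowMinor (firstRows hm) (pencilBasis hm t) = 1 from
      maximalMinors_pencilBasis_firstRows hm t]
    exact one_ne_zero

theorem finrank_pencil (t : ℝ) : finrank ℝ (pencil hm t) = m + 1 := by
  rw [pencil, finrank_span_eq_card (linearIndependent_pencilBasis hm t), Fintype.card_fin]

theorem pencilBasis_mem (t : ℝ) (j : Fin (m + 1)) : pencilBasis hm t j ∈ pencil hm t :=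
  Submodule.subset_span ⟨j, rfl⟩

theorem coord_lastIndex_of_mem_pencil {t : ℝ} {x : EuclideanSpace ℝ (Fin n)}
    (hx : x ∈ pencil hm t) :
    x (lastIndex hm) = t * x (Fin.castLE (by omega) (Fin.last m)) := by
  rw [pencil, Submodule.mem_span_range_iff_exists_fun] at hx
  obtain ⟨c, rfl⟩ := hx
  simp [pencilBasis_lastIndex, pencilBasis_castLE, mul_comm]

theorem pencil_injective : Function.Injective (pencil hm) := by
  intro s t h
  have := coord_lastIndex_of_mem_pencil hm (h ▸ pencilBasis_mem hm s (Fin.last m))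
  simpa [pencilBasis_lastIndex, pencilBasis_castLE] using this

/-- Otherwise the subspace would be rational. A rational vector in it has coordinates satisfying
`x_{m+1} = ξ x_m`, so `x_m = 0`; but `x_m` does not vanish identically on the subspace. -/
theorem pencil_mem_irrationalSubspaces {ξ : ℝ} (hξ : Irrational ξ) :
    pencil hm ξ ∈ irrationalSubspaces n (m + 1) (m + 1) (m + 1) := by
  refine ⟨finrank_pencil hm ξ, ?_⟩
  rintro B ⟨hB, b, hb⟩
  by_contra! hle
  have hAB : pencil hm ξ = B := by
    have h1 := Submodule.eq_of_le_of_finrank_le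
      (inf_le_left : pencil hm ξ ⊓ B ≤ pencil hm ξ) (by rw [finrank_pencil]; exact hle)
    have h2 := Submodule.eq_of_le_of_finrank_le
      (inf_le_right : pencil hm ξ ⊓ B ≤ B) (by rw [hB]; exact hle)
    exact h1.symm.trans h2
  let φ : B →ₗ[ℝ] ℝ :=
    (EuclideanSpace.proj (𝕜 := ℝ) (Fin.castLE (by omega : m + 1 ≤ n) (Fin.last m))).toLinearMap ∘ₗ
      B.subtype
  have hφ : φ = 0 := by
    refine b.ext fun i => ?_
    have h := coord_lastIndex_of_mem_pencil hm (hAB.ge (b i).2)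
    obtain ⟨q, hq⟩ := hb i (lastIndex hm)
    obtain ⟨r, hr⟩ := hb i (Fin.castLE (by omega) (Fin.last m))
    change (b i : EuclideanSpace ℝ (Fin n)) (Fin.castLE (by omega) (Fin.last m)) = 0
    rw [hq, hr] at h
    rw [hr]
    by_contra hr0
    have hr0' : r ≠ 0 := fun h0 => hr0 (by rw [h0, Rat.cast_zero])
    exact (hξ.mul_ratCast hr0') ⟨q, h⟩
  have h := LinearMap.congr_fun hφ ⟨pencilBasis hm ξ (Fin.last m), hAB.le (pencilBasis_mem hm ξ _)⟩
  change pencilBasis hm ξ (Fin.last m) (Fin.castLE (by omega) (Fin.last m)) = 0 at h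
  rw [pencilBasis_castLE, if_pos rfl] at h
  exact one_ne_zero h

theorem pencil_mem_rationalSubspaces (t : ℚ) :
    pencil hm (t : ℝ) ∈ rationalSubspaces n (m + 1) := by
  let e := finCongr (finrank_pencil hm t)
  let b : Basis (Fin (m + 1)) ℝ (pencil hm (t : ℝ)) :=
    Basis.span (linearIndependent_pencilBasis hm t)
  have hb : ∀ j, (b j : EuclideanSpace ℝ (Fin n)) = pencilBasis hm t j :=
    fun j => congrArg Subtype.val
      (Basis.span_apply (linearIndependent_pencilBasis hm (t : ℝ)) j)
  refine ⟨finrank_pencil hm t, b.reindex e.symm, fun i k => ?_⟩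
  rw [Basis.reindex_apply, hb, pencilBasis_apply, Equiv.symm_symm]
  refine ⟨(if k = Fin.castLE (by omega) (e i) then 1 else 0) +
    (if e i = Fin.last m then t else 0) * (if k = lastIndex hm then 1 else 0), ?_⟩
  split_ifs <;> simp

/-! ### Approximations of `ξ` give approximations of the subspace -/

theorem angleSine_pencil_le (s t : ℝ) :
    angleSine (pencil hm s) (pencil hm t) (m + 1) ≤ |s - t| := by
  -- The common vectors `e_0, …, e_{m-1}` serve as the first `m` pairs, with angle `0`. In the last
  -- minimization, the vectors `e_m + s e_{m+1}` and `e_m + t e_{m+1}` compete.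
  let Z : ℕ → EuclideanSpace ℝ (Fin n) := fun i =>
    if h : i < n then EuclideanSpace.single ⟨i, h⟩ 1 else 0
  have hZ : ∀ (i : ℕ) (h : i < n), Z i = EuclideanSpace.single ⟨i, h⟩ 1 := fun i h => dif_pos h
  have orth : ∀ (i : ℕ) (x : EuclideanSpace ℝ (Fin n)),
      (∀ k (_ : k < i) (h : k < n), x ⟨k, h⟩ = 0) →
      x ∈ (Submodule.span ℝ (Z '' Set.Iio i))ᗮ := by
    intro i x hx
    rw [Submodule.mem_orthogonal]
    intro u hu
    induction hu using Submodule.span_induction with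
    | mem u hu =>
      obtain ⟨k, hk, rfl⟩ := hu
      by_cases h : k < n
      · rw [hZ k h, EuclideanSpace.inner_single_left, hx k hk h, mul_zero]
      · simp [Z, h]
    | zero => simp
    | add u v _ _ hu hv => rw [inner_add_left, hu, hv, add_zero]
    | smul c u _ hu => rw [inner_smul_left, hu, mul_zero]
  have mem : ∀ (r : ℝ) (i : ℕ), i < m → Z i ∈ pencil hm r := by
    intro r i hi
    have : pencilBasis hm r ⟨i, by omega⟩ = Z i := by
      have hne : (⟨i, by omega⟩ : Fin (m + 1)) ≠ Fin.last m := fun h => by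
        have := congrArg Fin.val h
        simp only [Fin.val_last] at this
        omega
      rw [hZ i (by omega), pencilBasis, if_neg hne, zero_smul, add_zero]
      rfl
    exact this ▸ pencilBasis_mem hm r _
  have mem_last : ∀ r : ℝ, pencilBasis hm r (Fin.last m) ∈
      pencil hm r ⊓ (Submodule.span ℝ (Z '' Set.Iio m))ᗮ := by
    refine fun r => ⟨pencilBasis_mem hm r _, orth m _ fun k hk h => ?_⟩
    have := pencilBasis_castLE hm r ⟨k, by omega⟩ (Fin.last m)
    rw [if_neg (by intro h; have := congrArg Fin.val h; simp only [Fin.val_last] at this; omega)]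
      at this
    exact this
  have one_le : ∀ r : ℝ, 1 ≤ ‖pencilBasis hm r (Fin.last m)‖ := by
    intro r
    have := PiLp.norm_apply_le (pencilBasis hm r (Fin.last m))
      (Fin.castLE (by omega) (Fin.last m))
    rwa [pencilBasis_castLE, if_pos rfl, norm_one] at this
  have ne_zero : ∀ r : ℝ, pencilBasis hm r (Fin.last m) ≠ 0 := fun r =>
    norm_pos_iff.1 (zero_lt_one.trans_le (one_le r))
  have ne_bot : ∀ r : ℝ, pencil hm r ⊓ (Submodule.span ℝ (Z '' Set.Iio m))ᗮ ≠ ⊥ := fun r =>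
    (Submodule.ne_bot_iff _).2 ⟨_, mem_last r, ne_zero r⟩
  obtain ⟨x, y, hxy⟩ := exists_isMinimizingPair (ne_bot s) (ne_bot t)
  have img : ∀ (z : EuclideanSpace ℝ (Fin n)) (i : ℕ), i ≤ m →
      Function.update Z m z '' Set.Iio i = Z '' Set.Iio i := fun z i hi =>
    Set.image_congr fun k hk => Function.update_of_ne (by have : k < i := hk; omega) _ _
  have sys : IsAngleSystem (pencil hm s) (pencil hm t) (m + 1) (Function.update Z m x)
      (Function.update Z m y) := by
    intro i hi
    rw [img x i (by omega), img y i (by omega)]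
    rcases Nat.lt_succ_iff_lt_or_eq.1 hi with hi | rfl
    · rw [Function.update_of_ne hi.ne, Function.update_of_ne hi.ne]
      have hi' : Z i ∈ (Submodule.span ℝ (Z '' Set.Iio i))ᗮ := by
        refine orth i _ fun k hk h => ?_
        rw [hZ i (by omega)]
        simp [Fin.ext_iff, hk.ne]
      have hn : ‖Z i‖ = 1 := by rw [hZ i (by omega)]; simp
      refine ⟨⟨mem s i hi, hi'⟩, ⟨mem t i hi, hi'⟩, hn, hn, fun X' _ Y' _ _ _ => ?_⟩
      have : psi (Z i) (Z i) = 0 := by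
        rw [psi, InnerProductGeometry.angle_self (norm_ne_zero_iff.1 (by rw [hn]; exact one_ne_zero)),
          Real.sin_zero]
      rw [this]
      exact psi_nonneg _ _
    · rw [Function.update_self, Function.update_self]
      exact hxy
  have h1 := angleSine_le sys
  rw [Nat.add_sub_cancel, Function.update_self, Function.update_self] at h1
  have h2 := hxy.psi_le _ (mem_last s) _ (mem_last t) (ne_zero s) (ne_zero t)
  have h3 := psi_mul_norm_le (pencilBasis hm s (Fin.last m)) (pencilBasis hm t (Fin.last m))
  have h4 : ‖pencilBasis hm s (Fin.last m) - pencilBasis hm t (Fin.last m)‖ = |s - t| := by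
    simp only [pencilBasis, if_true]
    rw [add_sub_add_left_eq_sub, ← sub_smul, norm_smul]
    simp
  rw [h4] at h3
  exact (h1.trans h2).trans ((le_mul_of_one_le_right (psi_nonneg _ _) (one_le s)).trans h3)

theorem exists_height_pencil_le (ξ : ℝ) :
    ∃ D ≥ 1, ∀ (p : ℤ) (q : ℕ), 1 ≤ q → |ξ - p / q| ≤ 1 →
      height (m + 1) (pencil hm ((p : ℝ) / q)) ≤ D * q := by
  have hcont : Continuous fun t : ℝ => maximalMinors (pencilBasis hm t) := by
    refine (differentiable_maximalMinors n (m + 1)).continuous.comp (continuous_pi fun j => ?_)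
    unfold pencilBasis
    split_ifs <;> fun_prop
  obtain ⟨M, hM⟩ := (isCompact_closedBall ξ 1).exists_bound_of_continuousOn hcont.continuousOn
  have hM0 : 0 ≤ M := (norm_nonneg _).trans (hM ξ (by simp))
  refine ⟨√(Fintype.card (Fin (m + 1) ↪o Fin n)) * M + 1,
    le_add_of_nonneg_left (mul_nonneg (Real.sqrt_nonneg _) hM0), fun p q hq hpq => ?_⟩
  have hq0 : (q : ℝ) ≠ 0 := by exact_mod_cast (by omega : q ≠ 0)
  set t : ℝ := (p : ℝ) / q with ht
  -- Multiplying the last basis vector by `q` makes the matrix integral and multiplies each minor by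
  -- `q`; the minors themselves are bounded for `t` near `ξ`.
  let z : (Fin (m + 1) ↪o Fin n) → ℤ := fun I => (Matrix.of fun i j =>
    (if I i = Fin.castLE (by omega) j then (if j = Fin.last m then (q : ℤ) else 1) else 0) +
      (if j = Fin.last m then p else 0) * (if I i = lastIndex hm then 1 else 0)).det
  have hz : (fun I => (z I : ℝ)) = (q : ℝ) • maximalMinors (pencilBasis hm t) := by
    ext I
    have h1 := Matrix.det_mul_row (fun j : Fin (m + 1) => if j = Fin.last m then (q : ℝ) else 1)
      (Matrix.of fun i j => pencilBasis hm t j (I i))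
    rw [Finset.prod_ite_eq' Finset.univ (Fin.last m) fun _ => (q : ℝ),
      if_pos (Finset.mem_univ _)] at h1
    rw [Pi.smul_apply, smul_eq_mul, maximalMinors, ← h1]
    refine (RingHom.map_det (Int.castRingHom ℝ) _).trans ?_
    congr 1
    ext i j
    simp only [RingHom.mapMatrix_apply, Matrix.map_apply, Matrix.of_apply, pencilBasis_apply]
    by_cases hj : j = Fin.last m
    · simp only [hj, if_true, ht]
      simp only [eq_intCast, Int.cast_add, Int.cast_mul, Int.cast_ite, Int.cast_natCast,
        Int.cast_zero, Int.cast_one]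
      split_ifs <;> field_simp
      all_goals simp
    · simp [hj]
  have hrep : IsPluckerRepresentative (pencil hm t) fun I => (z I : ℝ) :=
    ⟨pencilBasis hm t, linearIndependent_pencilBasis hm t, rfl, q, hq0, hz⟩
  refine (height_le hrep).trans ?_
  have hbound : ∀ I, |(z I : ℝ)| ≤ q * M := by
    intro I
    rw [congrFun hz I, Pi.smul_apply, smul_eq_mul, abs_mul, Nat.abs_cast]
    refine mul_le_mul_of_nonneg_left ?_ (Nat.cast_nonneg q)
    refine (norm_le_pi_norm (maximalMinors (pencilBasis hm t)) I).trans (hM t ?_)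
    rwa [Metric.mem_closedBall, Real.dist_eq, abs_sub_comm]
  refine (sqrt_sum_sq_le (mul_nonneg (Nat.cast_nonneg q) hM0) hbound).trans ?_
  nlinarith [Nat.cast_nonneg (α := ℝ) q]

theorem infinite_of_liouvilleWith {ξ b b' : ℝ} (hξ : LiouvilleWith b ξ) (hb' : 0 < b')
    (hlt : b' < b) :
    {B | B ∈ rationalSubspaces n (m + 1) ∧
      angleSine (pencil hm ξ) B (m + 1) ≤ 1 / height (m + 1) B ^ b'}.Infinite := by
  intro hfin
  obtain ⟨D, hD, hheight⟩ := exists_height_pencil_le hm ξ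
  -- Finitely many parameters other than `ξ` would leave a punctured neighbourhood of `ξ` free of
  -- them, yet good approximations `p/q ≠ ξ` enter it.
  have hT : (pencil hm ⁻¹' {B | B ∈ rationalSubspaces n (m + 1) ∧
      angleSine (pencil hm ξ) B (m + 1) ≤ 1 / height (m + 1) B ^ b'} \ {ξ}).Finite :=
    (hfin.preimage (pencil_injective hm).injOn).subset Set.sdiff_subset
  obtain ⟨δ, hδ, hball⟩ := Metric.isOpen_iff.1 hT.isClosed.isOpen_compl ξ (fun h => h.2 rfl)
  -- The gap between `b'` and `c` absorbs the constant `D` of the height bound.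
  obtain ⟨c, hc1, hc2⟩ := exists_between hlt
  have hc0 : 0 < c := hb'.trans hc1
  have ev1 : ∀ᶠ q : ℕ in Filter.atTop, D ^ b' ≤ (q : ℝ) ^ (c - b') :=
    ((tendsto_rpow_atTop (sub_pos.2 hc1)).comp tendsto_natCast_atTop_atTop).eventually
      (Filter.eventually_ge_atTop _)
  have ev2 : ∀ᶠ q : ℕ in Filter.atTop, (q : ℝ) ^ (-c) < δ :=
    ((tendsto_rpow_neg_atTop hc0).comp tendsto_natCast_atTop_atTop).eventually
      (Filter.Tendsto.eventually_lt_const hδ Filter.tendsto_id)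
  obtain ⟨q, ⟨h1, h2, hq⟩, p, hne, hp⟩ :=
    ((ev1.and (ev2.and (Filter.eventually_ge_atTop 1))).and_frequently
      (hξ.frequently_lt_rpow_neg hc2)).exists
  have hq1 : (1 : ℝ) ≤ q := by exact_mod_cast hq
  have hq0 : (0 : ℝ) < q := zero_lt_one.trans_le hq1
  have hrat : pencil hm ((p : ℝ) / q) ∈ rationalSubspaces n (m + 1) := by
    have := pencil_mem_rationalSubspaces hm ((p : ℚ) / q)
    push_cast at this
    exact this
  have hH := hheight p q hq (hp.le.trans (Real.rpow_le_one_of_one_le_of_nonpos hq1 (by linarith)))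
  have hH1 := one_le_height hrat
  refine hball (a := (p : ℝ) / q) ?_ ⟨⟨hrat, ?_⟩, fun h => hne h.symm⟩
  · rw [Metric.mem_ball, dist_comm, Real.dist_eq]
    exact hp.trans h2
  · refine (angleSine_pencil_le hm _ _).trans (hp.le.trans ?_)
    rw [Real.rpow_neg hq0.le, ← one_div]
    apply one_div_le_one_div_of_le (Real.rpow_pos_of_pos (by linarith) _)
    calc height (m + 1) (pencil hm ((p : ℝ) / q)) ^ b' ≤ (D * q) ^ b' :=
          Real.rpow_le_rpow (by linarith) hH hb'.le
      _ = D ^ b' * (q : ℝ) ^ b' := Real.mul_rpow (by linarith) hq0.le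
      _ ≤ (q : ℝ) ^ (c - b') * (q : ℝ) ^ b' := by gcongr
      _ = (q : ℝ) ^ c := by rw [← Real.rpow_add hq0, sub_add_cancel]

/-! ### Approximations of the subspace give approximations of `ξ` -/

/-- A rational subspace which is close to `pencil hm ξ` has a Plücker representative whose first
two relevant entries provide a good rational approximation of `ξ`. -/
theorem exists_approx_of_angleSine_lt (ξ : ℝ) :
    ∃ ε > 0, ∃ C > 0, ∃ D > 0, ∀ B ∈ rationalSubspaces n (m + 1), ∀ ρ < ε,
      angleSine (pencil hm ξ) B (m + 1) < ρ → ∃ p q : ℤ, q ≠ 0 ∧ |ξ - p / q| ≤ C * ρ ∧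
        |(q : ℝ)| ≤ 2 * height (m + 1) B ∧ height (m + 1) B ≤ D * |(q : ℝ)| := by
  set a := pencilBasis hm ξ with ha
  obtain ⟨L, hL, δ, hδ, hlip⟩ := exists_norm_maximalMinors_sub_le a
  set K : ℝ := (m + 1 : ℕ) * (‖a‖ + 1) with hK
  have hK0 : 0 < K := by positivity
  set S : ℝ := √(Fintype.card (Fin (m + 1) ↪o Fin n)) with hS
  -- The first bound keeps the perturbed basis where the minors are Lipschitz, the second keeps its
  -- first minor at least `1/2`.
  refine ⟨min (δ / K) (1 / (2 * (L * K))), by positivity, 2 * (L * K * (1 + |ξ|)), by positivity,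
    S * (2 * (‖maximalMinors a‖ + 1)) + 1, by positivity, fun B hB ρ hρ hang => ?_⟩
  have hρ0 : 0 ≤ ρ := by
    refine le_trans ?_ hang.le
    refine Real.sInf_nonneg ?_
    rintro _ ⟨X, Y, -, rfl⟩
    exact psi_nonneg _ _
  have hρ1 : K * ρ < δ := by
    have := hρ.trans_le (min_le_left _ _)
    rwa [lt_div_iff₀' hK0] at this
  have hρ2 : L * (K * ρ) ≤ 1 / 2 := by
    have := (hρ.trans_le (min_le_right _ _)).le
    rw [le_div_iff₀ (by positivity)] at this
    linarith
  have hnear : ∀ j, ∃ y ∈ B, ‖a j - y‖ ≤ K * ρ := by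
    intro j
    obtain ⟨y, hy, h⟩ := exists_norm_sub_le_of_angleSine_lt (finrank_pencil hm ξ) hB.1 hang
      (pencilBasis_mem hm ξ j)
    refine ⟨y, hy, h.trans ?_⟩
    have h1 : ‖pencilBasis hm ξ j‖ ≤ ‖a‖ + 1 := (norm_le_pi_norm a j).trans (by linarith)
    calc ((m + 1 : ℕ) : ℝ) * ρ * ‖pencilBasis hm ξ j‖ ≤ ((m + 1 : ℕ) : ℝ) * ρ * (‖a‖ + 1) := by
          gcongr
      _ = K * ρ := by rw [hK]; ring
  choose b hbB hb using hnear
  have hba : ‖b - a‖ ≤ K * ρ := by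
    refine (pi_norm_le_iff_of_nonneg (by positivity)).2 fun j => ?_
    rw [Pi.sub_apply, norm_sub_rev]
    exact hb j
  have hminor : ‖maximalMinors b - maximalMinors a‖ ≤ L * (K * ρ) :=
    (hlip b (hba.trans_lt hρ1)).trans (by gcongr)
  have hminor' : ∀ I, |maximalMinors b I - maximalMinors a I| ≤ L * (K * ρ) := fun I =>
    (norm_le_pi_norm (maximalMinors b - maximalMinors a) I).trans hminor
  have h1 := hminor' (firstRows hm)
  have h2 := hminor' (secondRows hm)
  rw [ha, maximalMinors_pencilBasis_firstRows] at h1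
  rw [ha, maximalMinors_pencilBasis_secondRows] at h2
  have hb1 : 1 / 2 ≤ maximalMinors b (firstRows hm) := by
    have := (abs_le.1 h1).1
    linarith
  have hbli : LinearIndependent ℝ b :=
    linearIndependent_of_rowMinor_ne_zero (f := firstRows hm)
      (ne_of_gt (lt_of_lt_of_le (by norm_num) hb1))
  have hspan : Submodule.span ℝ (Set.range b) = B := by
    apply Submodule.eq_of_le_of_finrank_eq
    · rw [Submodule.span_le]
      rintro _ ⟨j, rfl⟩
      exact hbB j
    · rw [finrank_span_eq_card hbli, Fintype.card_fin, hB.1]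
  obtain ⟨z, hz, hzlt⟩ := exists_representative_lt hB
  obtain ⟨c, hc⟩ := hz.exists_eq_smul hspan.ge
  have hzc : ∀ I, (z I : ℝ) = c * maximalMinors b I := fun I => congrFun hc I
  have hc0 : c ≠ 0 := by
    rintro rfl
    obtain ⟨I, hI⟩ := hz.exists_ne_zero
    exact hI (by rw [hzc, zero_mul])
  have hcq : |c| ≤ 2 * |(z (firstRows hm) : ℝ)| := by
    rw [hzc, abs_mul, abs_of_pos (lt_of_lt_of_le (by norm_num) hb1 :
      0 < maximalMinors b (firstRows hm))]
    nlinarith [abs_nonneg c]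
  have hq0 : (z (firstRows hm) : ℝ) ≠ 0 := by
    rw [hzc]
    exact mul_ne_zero hc0 (ne_of_gt (lt_of_lt_of_le (by norm_num) hb1))
  have hqpos : 0 < |(z (firstRows hm) : ℝ)| := abs_pos.2 hq0
  refine ⟨z (secondRows hm), z (firstRows hm), by exact_mod_cast hq0, ?_, ?_, ?_⟩
  · have h3 : |ξ * maximalMinors b (firstRows hm) - maximalMinors b (secondRows hm)| ≤
        L * (K * ρ) * (1 + |ξ|) := by
      have : ξ * maximalMinors b (firstRows hm) - maximalMinors b (secondRows hm) =
          ξ * (maximalMinors b (firstRows hm) - 1) - (maximalMinors b (secondRows hm) - ξ) := by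
        ring
      rw [this]
      refine (abs_sub _ _).trans ?_
      rw [abs_mul]
      nlinarith [mul_le_mul_of_nonneg_left h1 (abs_nonneg ξ)]
    have h4 : ξ - z (secondRows hm) / z (firstRows hm) =
        c * (ξ * maximalMinors b (firstRows hm) - maximalMinors b (secondRows hm)) /
          z (firstRows hm) := by
      rw [eq_div_iff hq0, sub_mul, div_mul_cancel₀ _ hq0, hzc, hzc]
      ring
    rw [h4, abs_div, abs_mul, div_le_iff₀ hqpos]
    calc |c| * |ξ * maximalMinors b (firstRows hm) - maximalMinors b (secondRows hm)| ≤
          (2 * |(z (firstRows hm) : ℝ)|) * (L * (K * ρ) * (1 + |ξ|)) := by gcongr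
      _ = 2 * (L * K * (1 + |ξ|)) * ρ * |(z (firstRows hm) : ℝ)| := by ring
  · have h3 := abs_le_sqrt_sum_sq (fun I => (z I : ℝ)) (firstRows hm)
    have h4 := one_le_height hB
    linarith
  · refine (height_le hz).trans ?_
    have h3 : ∀ I, |(z I : ℝ)| ≤
        2 * |(z (firstRows hm) : ℝ)| * (‖maximalMinors a‖ + 1) := by
      intro I
      rw [hzc I, abs_mul]
      refine mul_le_mul hcq ?_ (abs_nonneg _) (by positivity)
      have h4 : |maximalMinors a I| ≤ ‖maximalMinors a‖ := norm_le_pi_norm (maximalMinors a) I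
      have h5 := hminor' I
      have h6 := abs_sub_abs_le_abs_sub (maximalMinors b I) (maximalMinors a I)
      linarith
    refine (sqrt_sum_sq_le (by positivity) h3).trans ?_
    rw [← hS]
    nlinarith

theorem liouvilleWith_of_infinite {ξ b : ℝ} (hξ : Irrational ξ) (hb : 0 < b)
    (hinf : {B | B ∈ rationalSubspaces n (m + 1) ∧
      angleSine (pencil hm ξ) B (m + 1) ≤ 1 / height (m + 1) B ^ b}.Infinite) :
    LiouvilleWith b ξ := by
  obtain ⟨ε, hε, C, hC, D, hD, happrox⟩ := exists_approx_of_angleSine_lt hm ξ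
  refine ⟨C * (2 * 2 ^ b) + 1, Filter.frequently_atTop.2 fun N => ?_⟩
  have ev : ∀ᶠ H : ℝ in Filter.atTop, H ^ (-b) < ε / 2 :=
    Filter.Tendsto.eventually_lt_const (by positivity) (tendsto_rpow_neg_atTop hb)
  -- A height beyond `D * N` forces `|q| ≥ N`, since `H(B) ≤ D |q|`.
  obtain ⟨H₀, hH₀⟩ := Filter.eventually_atTop.1 (ev.and (Filter.eventually_ge_atTop (D * N)))
  obtain ⟨B, ⟨hB, hang⟩, hB'⟩ := (hinf.sdiff (finite_height_le n (m + 1) H₀)).nonempty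
  have hHB : H₀ ≤ height (m + 1) B := by
    by_contra! h
    exact hB' ⟨hB, h.le⟩
  set H := height (m + 1) B
  obtain ⟨hsmall, hlarge⟩ := hH₀ H hHB
  have hH0 : 0 < H := zero_lt_one.trans_le (one_le_height hB)
  have hHb := Real.rpow_pos_of_pos hH0 b
  rw [Real.rpow_neg hH0.le, ← one_div] at hsmall
  -- Doubling provides the strict inequality needed to extract an angle system from the infimum.
  have hlt : 1 / H ^ b < 2 * (1 / H ^ b) := by
    have : 0 < 1 / H ^ b := by positivity
    linarith
  obtain ⟨p, q, hq, hpq, hqH, hHq⟩ :=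
    happrox B hB (2 * (1 / H ^ b)) (by linarith) (hang.trans_lt hlt)
  have hq' : (q : ℝ) ≠ 0 := by exact_mod_cast hq
  have hqpos : 0 < |(q : ℝ)| := abs_pos.2 hq'
  have hcast : ((q.natAbs : ℕ) : ℝ) = |(q : ℝ)| := Nat.cast_natAbs q |>.trans (Int.cast_abs)
  -- `LiouvilleWith` requires natural denominators, so the sign of `q` moves to the numerator.
  have hfrac : ((q.sign * p : ℤ) : ℝ) / q.natAbs = p / q := by
    rw [hcast, div_eq_div_iff hqpos.ne' hq']
    have : q.sign * q = |q| := Int.sign_mul_self_eq_abs q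
    have h : (q.sign : ℝ) * q = |(q : ℝ)| := by exact_mod_cast this
    push_cast
    linear_combination (p : ℝ) * h
  refine ⟨q.natAbs, ?_, q.sign * p, ?_, ?_⟩
  · have : (N : ℝ) ≤ q.natAbs := by
      rw [hcast]
      exact le_of_mul_le_mul_left (hlarge.trans hHq) hD
    exact_mod_cast this
  · rw [hfrac]
    intro h
    exact hξ ⟨(p : ℚ) / q, by push_cast; exact h.symm⟩
  · rw [hfrac, hcast]
    have hqb := Real.rpow_pos_of_pos hqpos b
    have h1 : |(q : ℝ)| ^ b ≤ 2 ^ b * H ^ b := by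
      rw [← Real.mul_rpow (by norm_num) hH0.le]
      exact Real.rpow_le_rpow hqpos.le hqH hb.le
    refine hpq.trans_lt ?_
    rw [lt_div_iff₀ hqb]
    calc C * (2 * (1 / H ^ b)) * |(q : ℝ)| ^ b ≤ C * (2 * (1 / H ^ b)) * (2 ^ b * H ^ b) := by
          gcongr
      _ = C * (2 * 2 ^ b) := by field_simp
      _ < C * (2 * 2 ^ b) + 1 := lt_add_one _

/-! ### Computation of the exponent and conclusion -/

theorem exponent_eq_of_forall {A : Submodule ℝ (EuclideanSpace ℝ (Fin n))} {e j : ℕ} {β : EReal}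
    (hβ : 0 < β)
    (hlower : ∀ b : ℝ, 0 < b → (b : EReal) < β →
      {B | B ∈ rationalSubspaces n e ∧ angleSine A B j ≤ 1 / height e B ^ b}.Infinite)
    (hupper : ∀ b : ℝ, 0 < b →
      {B | B ∈ rationalSubspaces n e ∧ angleSine A B j ≤ 1 / height e B ^ b}.Infinite →
      (b : EReal) ≤ β) : exponent A e j = β := by
  apply le_antisymm
  · refine sSup_le ?_
    rintro _ ⟨b, ⟨hb, hinf⟩, rfl⟩
    exact hupper b hb hinf
  · refine le_of_forall_lt fun c hc => ?_
    obtain ⟨b, hcb, hb⟩ := EReal.lt_iff_exists_real_btwn.1 (max_lt hc hβ)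
    have hb0 : 0 < b := by exact_mod_cast (le_max_right c 0).trans_lt hcb
    exact ((le_max_left c 0).trans_lt hcb).trans_le
      (le_sSup ⟨b, ⟨hb0, hlower b hb0 hb⟩, rfl⟩)

end Pencil

end SubspaceApprox

end

theorem mainTheorem6 (n ℓ : ℕ) (hn : 2 ≤ n) (hℓ : 1 ≤ ℓ) (hℓn : ℓ ≤ n / 2) :
    Set.Icc ((1 + 1 / (2 * (ℓ : ℝ)) + √(1 + 1 / (4 * (ℓ : ℝ) ^ 2)) : ℝ) : EReal) ⊤ ⊆
      {β : EReal | ∃ A ∈ SubspaceApprox.irrationalSubspaces n ℓ ℓ ℓ,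
        SubspaceApprox.exponent A ℓ ℓ = β} := by
  rintro β ⟨hβ, -⟩
  -- The precise endpoint plays no role beyond being at least `2`, the smallest irrationality
  -- exponent of an irrational number.
  have two_le : (2 : ℝ) ≤ 1 + 1 / (2 * (ℓ : ℝ)) + √(1 + 1 / (4 * (ℓ : ℝ) ^ 2)) := by
    have h1 : (0 : ℝ) ≤ 1 / (2 * (ℓ : ℝ)) := by positivity
    have h2 : (1 : ℝ) ≤ √(1 + 1 / (4 * (ℓ : ℝ) ^ 2)) :=
      Real.one_le_sqrt.2 (le_add_of_nonneg_right (by positivity))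
    linarith
  have hβ2 : ((2 : ℝ) : EReal) ≤ β := le_trans (EReal.coe_le_coe_iff.2 two_le) hβ
  obtain ⟨m, rfl⟩ : ∃ m, ℓ = m + 1 := ⟨ℓ - 1, by omega⟩
  have hm : m + 2 ≤ n := by omega
  obtain ⟨ξ, hirr, hlow, hup⟩ : ∃ ξ : ℝ, Irrational ξ ∧
      (∀ b : ℝ, (b : EReal) < β → ∃ c, b < c ∧ LiouvilleWith c ξ) ∧
      ∀ b : ℝ, LiouvilleWith b ξ → (b : EReal) ≤ β := by
    induction β with
    | bot => exact absurd hβ2 (not_le.2 (EReal.bot_lt_coe 2))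
    | coe β =>
      have hβ2' : 2 ≤ β := EReal.coe_le_coe_iff.1 hβ2
      obtain ⟨ξ, h1, h2⟩ := exists_liouvilleWith_iff_le hβ2'
      exact ⟨ξ, h1.irrational (by linarith), fun b hb => ⟨β, EReal.coe_lt_coe_iff.1 hb, h1⟩,
        fun b hb => EReal.coe_le_coe_iff.2 (h2 b hb)⟩
    | top =>
      have h : Liouville (liouvilleNumber (2 : ℕ)) := liouville_liouvilleNumber le_rfl
      exact ⟨_, h.irrational, fun b _ => ⟨b + 1, lt_add_one b, h.liouvilleWith _⟩,
        fun b _ => le_top⟩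
  refine ⟨SubspaceApprox.pencil hm ξ, SubspaceApprox.pencil_mem_irrationalSubspaces hm hirr,
    SubspaceApprox.exponent_eq_of_forall (lt_of_lt_of_le ?_ hβ2) (fun b hb hbβ => ?_)
      fun b hb hinf => hup b (SubspaceApprox.liouvilleWith_of_infinite hm hirr hb hinf)⟩
  · exact_mod_cast (two_pos : (0 : ℝ) < 2)
  · obtain ⟨c, hbc, hc⟩ := hlow b hbβ
    exact SubspaceApprox.infinite_of_liouvilleWith hm hc hb hbc
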